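/- Let $(\Theta,\mathcal E)$ be a measurable space, $\nu$ a probability measure on it, and let $\omega=(\omega_n)_{n\ge 0}$ be i.i.d. with law $\nu$ (the environment). For $e\in\Theta$ let $\eta(e)$ be the law of a point process on $\mathbb R$, depending measurably on $e$. Given $\omega$, consider the branching random walk started from one ancestor at the origin, in which individuals reproduce independently of one another and the displacements of the children of an individual of generation $n$ from their parent form a point process with law $\eta(\omega_n)$. Let $P_\omega,E_\omega$ denote the quenched law and expectation, let $\mathbb P,\mathbb E$ denote the annealed law and expectation (so $\mathbb E[\,\cdot\,]=\int E_\omega[\,\cdot\,]$ integrated over the law of $\omega$), let $z^n_r$ be an enumeration of the positions of the individuals of generation $n$, and let $N$ be the number of children of the ancestor. Assume that $P_\omega[N<\infty]=1$ for a.e. $\omega$, and that $\mathbb E\log E_\omega[N]$ exists in $(-\infty,\infty]$ and is positive. For $e\in\Theta$ and $\theta\in\mathbb R$ let $m_e(\theta)$ be the mean of $\sum_z e^{-\theta z}$ over the points $z$ of a point process with law $\eta(e)$, and let $A=\{\theta\in\mathbb R:\int m_e(\theta)\,\nu(de)<\infty\}$. Let $\theta$ be an interior point of $A$, and assume that there is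 $\delta>0$ with $m_e(\theta)>\delta$ for $\nu$-a.e. $e$ (uniform ellipticity). Put $$W_n(\theta)=\frac{\sum_r e^{-\theta z^n_r}}{E_\omega\big[\sum_r e^{-\theta z^n_r}\big]}.$$ Then $m_e$ is differentiable at $\theta$ for $\nu$-a.e. $e$, the integral $$\kappa=\int\Big[-\theta\,\frac{m_e'(\theta)}{m_e(\theta)}+\log m_e(\theta)\Big]\nu(de)$$ converges absolutely, and $W_n(\theta)$ converges $\mathbb P$-almost surely to a finite limit $W(\theta)$. Moreover $\mathbb E[W(\theta)]=1$ if and only if $$\mathbb E\big[W_1(\theta)\,|\log W_1(\theta)|\big]<\infty\quad\text{and}\quad\kappa>0,$$ where $0\,|\log 0|=0$; and $\mathbb E[W(\theta)]=0$ if either of these two conditions fails. -/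

import Mathlib

open MeasureTheory ProbabilityTheory Filter Topology
open scoped ENNReal

namespace BRWRE

/-- An enumerated point configuration on the real line: the number of atoms (possibly infinite)
together with a list of positions. The atoms of `c` are `c.2 i` for `i < c.1`, counted with
multiplicity; the entries `c.2 i` with `c.1 ≤ i` carry no meaning. -/
abbrev PointConfig : Type := ℕ∞ × (ℕ → ℝ)

/-- A family tree decorated with displacements: to every potential individual `u` (an Ulam–Harris
label) it attaches the point configuration of the displacements of the children of `u`.
The root is `[]`, and `i :: u` is the `i`-th child of `u`; so the generation of `u` is
`u.length`. -/
abbrev Family : Type := List ℕ → PointConfig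

/-- The individual `u` is born. -/
def Alive (x : Family) : List ℕ → Prop
  | [] => True
  | i :: u => Alive x u ∧ (i : ℕ∞) < (x u).1

/-- The position on the real line of the individual `u`; the ancestor sits at the origin. -/
def position (x : Family) : List ℕ → ℝ
  | [] => 0
  | i :: u => position x u + (x u).2 i

open Classical in
/-- The sum of `exp (-θ z)` over the positions `z` of the individuals of the `n`-th generation. -/
noncomputable def expSum (θ : ℝ) (n : ℕ) (x : Family) : ℝ≥0∞ :=
  ∑' u : List ℕ, if u.length = n ∧ Alive x u
    then ENNReal.ofReal (Real.exp (-θ * position x u)) else 0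

open Classical in
/-- The sum of `exp (-θ z)` over the atoms `z` of a point configuration. -/
noncomputable def atomSum (θ : ℝ) (c : PointConfig) : ℝ≥0∞ :=
  ∑' i : ℕ, if (i : ℕ∞) < c.1 then ENNReal.ofReal (Real.exp (-θ * c.2 i)) else 0

section Model

variable {Θ : Type*} [MeasurableSpace Θ]

/-- The law of the i.i.d. environment sequence with one-time marginal `ν`. -/
noncomputable def envLaw (ν : Measure Θ) [IsProbabilityMeasure ν] : Measure (ℕ → Θ) :=
  Measure.infinitePi fun _ : ℕ => ν

/-- The quenched law of the branching random walk in the environment `ω`: the offspring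
configurations of all individuals are independent, and those of the individuals of generation `n`
have the law `η (ω n)`. -/
noncomputable def quenchedMeasure (η : Kernel Θ PointConfig) [IsMarkovKernel η] (ω : ℕ → Θ) :
    Measure Family :=
  Measure.infinitePi fun u : List ℕ => η (ω u.length)

instance (ν : Measure Θ) [IsProbabilityMeasure ν] : IsProbabilityMeasure (envLaw ν) := by
  unfold envLaw; infer_instance

instance (η : Kernel Θ PointConfig) [IsMarkovKernel η] (ω : ℕ → Θ) :
    IsProbabilityMeasure (quenchedMeasure η ω) := by
  unfold quenchedMeasure; infer_instance

theorem measurable_quenchedMeasure (η : Kernel Θ PointConfig) [IsMarkovKernel η] :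
    Measurable (quenchedMeasure η) := by
  refine Measurable.measure_of_isPiSystem_of_isProbabilityMeasure
    (generateFrom_squareCylinders (α := fun _ : List ℕ => PointConfig)).symm
    (isPiSystem_squareCylinders (fun _ => MeasurableSpace.isPiSystem_measurableSet)
      (fun _ => by simp)) ?_
  rintro _ ⟨s, t, ht, rfl⟩
  have ht' : ∀ u, MeasurableSet (t u) := fun u => ht u (Set.mem_univ u)
  have h : ∀ ω : ℕ → Θ, quenchedMeasure η ω ((s : Set (List ℕ)).pi t)
      = ∏ u ∈ s, η (ω u.length) (t u) := fun ω =>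
    Measure.infinitePi_pi _ (fun u _ => ht' u)
  simp only [h]
  exact Finset.measurable_prod _ fun u _ =>
    (η.measurable_coe (ht' u)).comp (measurable_pi_apply _)

/-- The quenched laws, as a Markov kernel. -/
noncomputable def quenchedLaw (η : Kernel Θ PointConfig) [IsMarkovKernel η] :
    Kernel (ℕ → Θ) Family where
  toFun := quenchedMeasure η
  measurable' := measurable_quenchedMeasure η

instance (η : Kernel Θ PointConfig) [IsMarkovKernel η] : IsMarkovKernel (quenchedLaw η) :=
  ⟨fun ω => inferInstanceAs (IsProbabilityMeasure (quenchedMeasure η ω))⟩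

/-- The annealed law on pairs (environment, family tree). -/
noncomputable def annealedLaw (ν : Measure Θ) [IsProbabilityMeasure ν]
    (η : Kernel Θ PointConfig) [IsMarkovKernel η] : Measure ((ℕ → Θ) × Family) :=
  envLaw ν ⊗ₘ quenchedLaw η

/-- The mean number of children of an individual living in the environment state `e`. -/
noncomputable def meanOffspring (η : Kernel Θ PointConfig) (e : Θ) : ℝ≥0∞ :=
  ∫⁻ c, (c.1 : ℝ≥0∞) ∂(η e)

/-- The expectation of the logarithm of the mean offspring number exists in `(-∞, ∞]` and is
positive: the integral of its negative part is smaller than that of its positive part. -/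
def PosMeanLogOffspring (ν : Measure Θ) (η : Kernel Θ PointConfig) : Prop :=
  ∫⁻ e, (-ENNReal.log (meanOffspring η e)).toENNReal ∂ν
    < ∫⁻ e, (ENNReal.log (meanOffspring η e)).toENNReal ∂ν

/-- `m_e(θ)`, the mean of the sum of `exp (-θ z)` over the displacements `z` of the children of
an individual living in the environment state `e`. -/
noncomputable def laplaceMean (η : Kernel Θ PointConfig) (e : Θ) (θ : ℝ) : ℝ≥0∞ :=
  ∫⁻ c, atomSum θ c ∂(η e)

/-- The set of the parameters `θ` for which `m(θ)` has a finite annealed mean. -/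
def finiteDomain (ν : Measure Θ) (η : Kernel Θ PointConfig) : Set ℝ :=
  {θ | ∫⁻ e, laplaceMean η e θ ∂ν < ∞}

/-- `-θ m_e'(θ) / m_e(θ) + log m_e(θ)`. -/
noncomputable def kappaIntegrand (η : Kernel Θ PointConfig) (θ : ℝ) (e : Θ) : ℝ :=
  -θ * (deriv (fun t => (laplaceMean η e t).toReal) θ / (laplaceMean η e θ).toReal)
    + Real.log (laplaceMean η e θ).toReal

/-- The additive martingale: the exponential sum over generation `n`, divided by its quenched
mean. -/
noncomputable def W (η : Kernel Θ PointConfig) [IsMarkovKernel η] (θ : ℝ) (n : ℕ)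
    (p : (ℕ → Θ) × Family) : ℝ≥0∞ :=
  expSum θ n p.2 / ∫⁻ x, expSum θ n x ∂(quenchedLaw η p.1)

/-- The limit of the additive martingale (as an upper limit, so that it is defined
everywhere). -/
noncomputable def Wlim (η : Kernel Θ PointConfig) [IsMarkovKernel η] (θ : ℝ)
    (p : (ℕ → Θ) × Family) : ℝ≥0∞ :=
  limsup (fun n => W η θ n p) atTop

end Model

end BRWRE

/-!
Biggins' theorem for a branching random walk in an i.i.d. random environment.

Give each individual its normalized weight, `exp (-θ z)` divided by the product of the means
`laplaceMean` along its line of descent, so that `W n` is the sum of the weights over generation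
`n`. Pick an environment state by `ν`, a family by `η`, and then a child with probability
proportional to its weight: this is the tilted law `tiltLaw`, under which the family is
size-biased by its normalized mass `familyMass`. For an i.i.d. sequence with this law let `S k` be
the random walk with steps `tiltStep`, minus the logarithm of the weight of the picked child, and
let `X k` be the masses of the families. The drift of the walk is `κ`; as `θ` is interior to the
domain of the annealed Laplace transform and the means are bounded below, the steps have finite
second moments.

Instead of a change of measure on trees, the proof uses truncation. Given a barrier `b`, drop the
descendants of every individual of a generation `k` whose weight times the mass of its family
exceeds `b k`. By the many-to-one formula (`lintegral_truncSum`), the annealed mean of the truncated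
sum over generation `n` is the probability that `exp (-S k) * X k ≤ b k` for all `k < n`.

* If `κ > 0` and `log⁺ X` is integrable (which is the `X log X` condition for `W 1`), then
  `exp (-S k) * X k ≤ exp (a - c k)` for all `k` with probability tending to one as `a → ∞`.
  For this barrier the second moment of the truncated sums grows by at most `exp (a - c k)` in
  generation `k`, so that no mass escapes and the limit has mean one
  (`one_le_lintegral_limsup_truncSum`).
* Otherwise `exp (-S k) * X k` is almost surely unbounded. If `log⁺ X` is not integrable, this is
  the second Borel-Cantelli lemma against the law of large numbers for `S`. If not, it suffices that
  `S` is unbounded below, as the mass of a family is at least the weight of one of its members: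
  for `κ < 0` by the law of large numbers, and for `κ = 0` by the central limit theorem and
  Kolmogorov's zero-one law, as the step is not degenerate (`not_ae_tiltStep_eq_zero`; this is
  where the positivity of the mean logarithm of the offspring number is used). So the truncated
  sums for a constant barrier tend to zero in mean; since the martingale is almost surely bounded,
  it is not affected by a large constant barrier, and its limit vanishes
  (`lintegral_limsup_truncSum_eq_zero`).

All independence arguments reduce to the fact that redrawing one coordinate of a product measure
does not change the law (`lintegral_infinitePi_update`).
-/

namespace BRWRE

/-! ### Resampling one coordinate of a product measure -/

/-- Under a product measure, redrawing one coordinate independently does not change the law. -/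
theorem lintegral_infinitePi_update {ι : Type*} [DecidableEq ι] {E : ι → Type*}
    [∀ i, MeasurableSpace (E i)] (μ : ∀ i, Measure (E i)) [∀ i, IsProbabilityMeasure (μ i)]
    (i : ι) {F : (∀ i, E i) → ℝ≥0∞} (hF : Measurable F) :
    ∫⁻ x, F x ∂Measure.infinitePi μ
      = ∫⁻ x, ∫⁻ y, F (Function.update x i y) ∂μ i ∂Measure.infinitePi μ := by
  have hm : Measurable fun p : (∀ i, E i) × E i => Function.update p.1 i p.2 := by
    refine measurable_pi_iff.2 fun j => ?_
    by_cases h : j = i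
    · subst h; simpa using measurable_snd
    · simp only [Function.update_of_ne h]; fun_prop
  have key : ((Measure.infinitePi μ).prod (μ i)).map
      (fun p => Function.update p.1 i p.2) = Measure.infinitePi μ := by
    refine Measure.eq_infinitePi _ fun s t ht => ?_
    have hs : MeasurableSet ((s : Set ι).pi t) :=
      MeasurableSet.pi s.countable_toSet fun j _ => ht j
    rw [Measure.map_apply hm hs]
    by_cases hi : i ∈ s
    · have : (fun p : (∀ i, E i) × E i => Function.update p.1 i p.2) ⁻¹' ((s : Set ι).pi t)
          = (((s.erase i : Finset ι) : Set ι).pi t) ×ˢ (t i) := by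
        ext p
        simp only [Set.mem_preimage, Set.mem_pi, Finset.mem_coe, Set.mem_prod, Finset.mem_erase]
        constructor
        · intro h
          refine ⟨fun j hj => ?_, by simpa using h i hi⟩
          simpa [Function.update_of_ne hj.1] using h j hj.2
        · rintro ⟨h1, h2⟩ j hj
          by_cases hji : j = i
          · subst hji; simpa using h2
          · simpa [Function.update_of_ne hji] using h1 j ⟨hji, hj⟩
      rw [this, Measure.prod_prod, Measure.infinitePi_pi _ fun j _ => ht j, mul_comm,
        Finset.mul_prod_erase s (fun j => μ j (t j)) hi]
    · have : (fun p : (∀ i, E i) × E i => Function.update p.1 i p.2) ⁻¹' ((s : Set ι).pi t)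
          = ((s : Set ι).pi t) ×ˢ Set.univ := by
        ext p
        simp only [Set.mem_preimage, Set.mem_pi, Finset.mem_coe, Set.mem_prod, Set.mem_univ,
          and_true]
        refine forall₂_congr fun j hj => ?_
        rw [Function.update_of_ne (by rintro rfl; exact hi hj)]
      rw [this, Measure.prod_prod, Measure.infinitePi_pi _ fun j _ => ht j, measure_univ, mul_one]
  conv_lhs => rw [← key]
  rw [lintegral_map hF hm,
    lintegral_prod (fun p => F (Function.update p.1 i p.2)) (hF.comp hm).aemeasurable]

/-! ### Random walks with a perturbation -/

section Walk

variable {S : Type*} [MeasurableSpace S] (Q : Measure S) [IsProbabilityMeasure Q]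

theorem iIndepFun_coord {Y : S → ℝ} (hY : Measurable Y) :
    iIndepFun (fun (n : ℕ) (y : ℕ → S) => Y (y n)) (Measure.infinitePi fun _ : ℕ => Q) :=
  iIndepFun_infinitePi fun _ => hY

theorem identDistrib_coord {Y : S → ℝ} (hY : Measurable Y) (n : ℕ) :
    IdentDistrib (fun y : ℕ → S => Y (y n)) Y (Measure.infinitePi fun _ : ℕ => Q) Q := by
  refine ⟨(hY.comp (measurable_pi_apply n)).aemeasurable, hY.aemeasurable, ?_⟩
  have := Measure.infinitePi_map_eval (fun _ : ℕ => Q) n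
  conv_rhs => rw [← this, Measure.map_map hY (measurable_pi_apply n)]
  rfl

theorem ae_forall_coord {p : S → Prop} (hp : ∀ᵐ s ∂Q, p s) :
    ∀ᵐ y ∂(Measure.infinitePi fun _ : ℕ => Q), ∀ n, p (y n) :=
  ae_all_iff.2 fun n =>
    (measurePreserving_eval_infinitePi (fun _ : ℕ => Q) n).quasiMeasurePreserving.ae hp

theorem ae_tendsto_walk_div {Y : S → ℝ} (hY : Measurable Y) (hint : Integrable Y Q) :
    ∀ᵐ y ∂(Measure.infinitePi fun _ : ℕ => Q),
      Tendsto (fun n : ℕ => (∑ i ∈ Finset.range n, Y (y i)) / n) atTop (𝓝 (∫ s, Y s ∂Q)) := by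
  have hid := identDistrib_coord Q hY
  have := strong_law_ae_real (μ := Measure.infinitePi fun _ : ℕ => Q)
    (fun n y => Y (y n)) ((hid 0).integrable_iff.2 hint)
    (fun i j hij => (iIndepFun_coord Q hY).indepFun hij) (fun i => (hid i).trans (hid 0).symm)
  rwa [(hid 0).integral_eq] at this

/-- A walk with positive drift beats perturbations whose positive part is integrable. -/
theorem ae_bddAbove_perturbed_walk {Y L : S → ℝ} (hY : Measurable Y) (hL : Measurable L)
    (hint : Integrable Y Q) (hLint : Integrable (fun s => max (L s) 0) Q) {c : ℝ} (hc : 0 < c)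
    (hκ : 2 * c < ∫ s, Y s ∂Q) :
    ∀ᵐ y ∂(Measure.infinitePi fun _ : ℕ => Q),
      BddAbove (Set.range fun k : ℕ => L (y k) - ∑ i ∈ Finset.range k, Y (y i) + c * k) := by
  have hmax : Measurable fun s => max (L s) 0 / c := (hL.max measurable_const).div_const c
  have hsum : ∑' j : ℕ, Q {s | max (L s) 0 / c ∈ Set.Ioi (j : ℝ)} < ∞ := by
    let _ : MeasureSpace S := ⟨Q⟩
    exact tsum_prob_mem_Ioi_lt_top (hLint.div_const c)
      (fun s => div_nonneg (le_max_right _ _) hc.le)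
  have hsum' : ∑' j : ℕ, (Measure.infinitePi fun _ : ℕ => Q)
      {y | max (L (y j)) 0 / c ∈ Set.Ioi (j : ℝ)} ≠ ∞ := by
    refine ne_of_eq_of_ne (tsum_congr fun j => ?_) hsum.ne
    exact (measurePreserving_eval_infinitePi (fun _ : ℕ => Q) j).measure_preimage
      (hmax measurableSet_Ioi).nullMeasurableSet
  filter_upwards [ae_tendsto_walk_div Q hY hint, ae_eventually_notMem hsum'] with y h1 h2
  refine IsBoundedUnder.bddAbove_range ⟨0, ?_⟩
  rw [eventually_map]
  filter_upwards [h1.eventually_const_lt hκ, h2, eventually_gt_atTop 0] with k hk1 hk2 hk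
  have hk' : (0 : ℝ) < k := by exact_mod_cast hk
  rw [lt_div_iff₀ hk'] at hk1
  simp only [Set.mem_Ioi, not_lt, div_le_iff₀ hc] at hk2
  have := (le_max_left (L (y k)) 0).trans hk2
  linarith

/-- If a perturbation dominates the opposite of the next step, the perturbed walk inherits the
unboundedness of the walk. -/
theorem ae_unbounded_of_walk_unbounded {Y L : S → ℝ} (hYL : ∀ᵐ s ∂Q, -Y s ≤ L s)
    (h : ∀ᵐ y ∂(Measure.infinitePi fun _ : ℕ => Q), ∀ a : ℝ, ∃ n : ℕ,
      a < -∑ i ∈ Finset.range n, Y (y i)) :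
    ∀ᵐ y ∂(Measure.infinitePi fun _ : ℕ => Q), ∀ a : ℝ, ∃ k : ℕ,
      a < L (y k) - ∑ i ∈ Finset.range k, Y (y i) := by
  filter_upwards [h, ae_forall_coord Q hYL] with y hy hl a
  obtain ⟨n, hn⟩ := hy (max a 0)
  obtain _ | k := n
  · simp at hn
  · refine ⟨k, ?_⟩
    rw [Finset.sum_range_succ] at hn
    have := (max_lt_iff.1 hn).1
    linarith [hl k]

theorem ae_walk_unbounded_of_neg {Y : S → ℝ} (hY : Measurable Y) (hint : Integrable Y Q)
    (hκ : ∫ s, Y s ∂Q < 0) :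
    ∀ᵐ y ∂(Measure.infinitePi fun _ : ℕ => Q), ∀ a : ℝ, ∃ n : ℕ,
      a < -∑ i ∈ Finset.range n, Y (y i) := by
  filter_upwards [ae_tendsto_walk_div Q hY hint] with y h a
  set κ := ∫ s, Y s ∂Q
  have h1 : ∀ᶠ n : ℕ in atTop, (∑ i ∈ Finset.range n, Y (y i)) / n < κ / 2 :=
    h.eventually_lt_const (by linarith)
  have h2 : Tendsto (fun n : ℕ => (-κ / 2) * (n : ℝ)) atTop atTop :=
    tendsto_natCast_atTop_atTop.const_mul_atTop (by linarith)
  obtain ⟨n, hn1, hn2, hn3⟩ :=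
    (h1.and ((h2.eventually_gt_atTop a).and (eventually_gt_atTop 0))).exists
  have hk' : (0 : ℝ) < n := by exact_mod_cast hn3
  rw [div_lt_iff₀ hk'] at hn1
  exact ⟨n, by linarith⟩

/-- Boundedness above of a random walk is a tail event, hence has probability zero or one. -/
theorem measure_bddAbove_walk_zero_or_one {Y : S → ℝ} (hY : Measurable Y) :
    (Measure.infinitePi fun _ : ℕ => Q)
        {y | BddAbove (Set.range fun n : ℕ => ∑ i ∈ Finset.range n, Y (y i))} = 0 ∨
      (Measure.infinitePi fun _ : ℕ => Q)
        {y | BddAbove (Set.range fun n : ℕ => ∑ i ∈ Finset.range n, Y (y i))} = 1 := by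
  have hm : ∀ i : ℕ, Measurable fun y : ℕ → S => Y (y i) :=
    fun i => hY.comp (measurable_pi_apply i)
  refine measure_zero_or_one_of_measurableSet_limsup_atTop
    (s := fun i : ℕ => MeasurableSpace.comap (fun y : ℕ → S => Y (y i)) inferInstance)
    (fun i => (hm i).comap_le) (iIndepFun_coord Q hY) ?_
  rw [limsup_eq_iInf_iSup_of_nat, MeasurableSpace.measurableSet_iInf]
  intro m
  -- dropping the first `m` steps shifts the walk by a constant
  have heq : {y : ℕ → S | BddAbove (Set.range fun n : ℕ => ∑ i ∈ Finset.range n, Y (y i))}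
      = {y | BddAbove (Set.range fun n : ℕ => ∑ i ∈ Finset.range n, Y (y (m + i)))} := by
    ext y
    simp only [Set.mem_ofPred_eq]
    have hsplit : ∀ n, ∑ i ∈ Finset.range (m + n), Y (y i)
        = ∑ i ∈ Finset.range m, Y (y i) + ∑ i ∈ Finset.range n, Y (y (m + i)) :=
      fun n => Finset.sum_range_add _ _ _
    constructor
    · rintro ⟨a, ha⟩
      refine ⟨a - ∑ i ∈ Finset.range m, Y (y i), ?_⟩
      rintro _ ⟨n, rfl⟩
      have := ha ⟨m + n, rfl⟩
      simp only [hsplit] at this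
      simp only; linarith
    · rintro ⟨a, ha⟩
      refine IsBoundedUnder.bddAbove_range ⟨a + ∑ i ∈ Finset.range m, Y (y i), ?_⟩
      rw [eventually_map]
      filter_upwards [eventually_ge_atTop m] with n hn
      obtain ⟨k, rfl⟩ := Nat.exists_eq_add_of_le hn
      have := ha ⟨k, rfl⟩
      simp only at this
      rw [hsplit]; linarith
  rw [heq]
  set 𝓜 : MeasurableSpace (ℕ → S) :=
    ⨆ i ≥ m, MeasurableSpace.comap (fun y : ℕ → S => Y (y i)) inferInstance with h𝓜
  have hmeas : ∀ i, @Measurable _ _ 𝓜 _ fun y : ℕ → S => Y (y (m + i)) := fun i =>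
    Measurable.mono (comap_measurable _)
      (le_iSup₂_of_le (f := fun i (_ : i ≥ m) =>
        MeasurableSpace.comap (fun y : ℕ → S => Y (y i)) inferInstance) (m + i)
        (Nat.le_add_right m i) le_rfl) le_rfl
  exact measurableSet_bddAbove_range (mδ := 𝓜) fun n =>
    Finset.measurable_sum (m := 𝓜) (Finset.range n) fun i _ => hmeas i

/-- A nondegenerate centred random walk with finite variance is unbounded from below: by the
central limit theorem it exceeds each level with a probability bounded away from zero, and
boundedness is a tail event. -/
theorem ae_walk_unbounded_of_centered {Y : S → ℝ} (hY : Measurable Y) (hL2 : MemLp Y 2 Q)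
    (hκ : ∫ s, Y s ∂Q = 0) (hne : ¬ ∀ᵐ s ∂Q, Y s = 0) :
    ∀ᵐ y ∂(Measure.infinitePi fun _ : ℕ => Q), ∀ a : ℝ, ∃ n : ℕ,
      a < -∑ i ∈ Finset.range n, Y (y i) := by
  set μ := Measure.infinitePi fun _ : ℕ => Q
  have hZ : Measurable fun s => -Y s := hY.neg
  have hid := identDistrib_coord Q hZ
  have hZ2 : MemLp (fun s => -Y s) 2 Q := hL2.neg
  have hmean : ∫ s, -Y s ∂Q = 0 := by rw [integral_neg, hκ, neg_zero]
  set v := Var[fun s => -Y s; Q] with hv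
  have hv0 : v ≠ 0 := by
    intro h
    refine hne ?_
    filter_upwards [ae_eq_integral_of_variance_eq_zero hZ2 h] with s hs
    rw [hmean] at hs; linarith
  have hclt := tendstoInDistribution_inv_sqrt_mul_sum_sub (P := μ)
    (X := fun n y => -Y (y n)) (Y := id) (P' := gaussianReal 0 v.toNNReal)
    (by rw [(hid 0).variance_eq]; exact ⟨aemeasurable_id, Measure.map_id⟩)
    ((hid 0).memLp_iff.2 hZ2) (iIndepFun_coord Q hZ) (fun i => (hid i).trans (hid 0).symm)
  set c : ℝ≥0∞ := gaussianReal 0 v.toNNReal (Set.Ioi 1) with hc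
  have hv0' : v.toNNReal ≠ 0 := by
    rw [Ne, Real.toNNReal_eq_zero, not_le]
    exact lt_of_le_of_ne (variance_nonneg _ _) (Ne.symm hv0)
  have hcpos : 0 < c := by
    rw [hc, pos_iff_ne_zero]
    intro h0
    have := gaussianReal_absolutelyContinuous' 0 hv0' h0
    simp at this
  have hport := ProbabilityMeasure.le_liminf_measure_open_of_tendsto hclt.tendsto
    (isOpen_Ioi (a := (1 : ℝ)))
  simp only [ProbabilityMeasure.coe_mk, Measure.map_id] at hport
  have hlevel : ∀ a : ℕ, μ {y | ∀ n : ℕ, -∑ i ∈ Finset.range n, Y (y i) ≤ a} ≤ 1 - c := by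
    intro a
    have hmS : ∀ n : ℕ, Measurable fun y : ℕ → S => -∑ i ∈ Finset.range n, Y (y i) := fun n =>
      (Finset.measurable_sum _ fun i _ => hY.comp (measurable_pi_apply i)).neg
    have hA : MeasurableSet {y : ℕ → S | ∀ n : ℕ, -∑ i ∈ Finset.range n, Y (y i) ≤ a} := by
      rw [Set.ofPred_forall]
      exact MeasurableSet.iInter fun n => measurableSet_le (hmS n) measurable_const
    have hle : c ≤ μ {y | ∀ n : ℕ, -∑ i ∈ Finset.range n, Y (y i) ≤ a}ᶜ := by
      refine hport.trans (liminf_le_of_frequently_le' (Eventually.frequently ?_))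
      have hsq : Tendsto (fun n : ℕ => √(n : ℝ)) atTop atTop :=
        Real.tendsto_sqrt_atTop.comp tendsto_natCast_atTop_atTop
      filter_upwards [hsq.eventually_ge_atTop (a + 1)] with n hn
      rw [Measure.map_apply_of_aemeasurable (hclt.forall_aemeasurable n) measurableSet_Ioi]
      refine measure_mono fun y hy => ?_
      have hm0 : ∫ y, -Y (y 0) ∂μ = 0 := by rw [(hid 0).integral_eq, hmean]
      simp only [Set.mem_preimage, Set.mem_Ioi, hm0, mul_zero, sub_zero] at hy
      simp only [Set.mem_compl_iff, Set.mem_ofPred_eq, not_forall, not_le]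
      refine ⟨n, ?_⟩
      have ha0 : (0 : ℝ) ≤ a := Nat.cast_nonneg a
      have hpos : 0 < √(n : ℝ) := by linarith
      rw [inv_mul_eq_div, lt_div_iff₀ hpos, Finset.sum_neg_distrib] at hy
      linarith
    rw [measure_compl hA (measure_ne_top _ _), measure_univ] at hle
    refine ENNReal.le_sub_of_add_le_left (ne_top_of_le_ne_top ENNReal.one_ne_top prob_le_one) ?_
    calc c + _ ≤ _ := add_le_add_left hle _
      _ = 1 := tsub_add_cancel_of_le prob_le_one
  have hB := measure_bddAbove_walk_zero_or_one Q hZ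
  have hBle : μ {y | BddAbove (Set.range fun n : ℕ => ∑ i ∈ Finset.range n, -Y (y i))} ≤ 1 - c := by
    have hUn : {y : ℕ → S | BddAbove (Set.range fun n : ℕ => ∑ i ∈ Finset.range n, -Y (y i))}
        = ⋃ a : ℕ, {y | ∀ n : ℕ, -∑ i ∈ Finset.range n, Y (y i) ≤ a} := by
      ext y
      simp only [Set.mem_ofPred_eq, Set.mem_iUnion, Finset.sum_neg_distrib]
      constructor
      · rintro ⟨a, ha⟩
        obtain ⟨k, hk⟩ := exists_nat_ge a
        exact ⟨k, fun n => (ha ⟨n, rfl⟩).trans hk⟩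
      · rintro ⟨a, ha⟩
        exact ⟨a, by rintro _ ⟨n, rfl⟩; exact ha n⟩
    have hmono : Monotone fun a : ℕ =>
        {y : ℕ → S | ∀ n : ℕ, -∑ i ∈ Finset.range n, Y (y i) ≤ a} :=
      fun a b hab y hy n => (hy n).trans (by exact_mod_cast hab)
    rw [hUn, hmono.measure_iUnion]
    exact iSup_le hlevel
  have hB0 : μ {y | BddAbove (Set.range fun n : ℕ => ∑ i ∈ Finset.range n, -Y (y i))} = 0 := by
    refine hB.resolve_right fun h1 => ?_
    have hlt : (1 : ℝ≥0∞) - c < 1 := ENNReal.sub_lt_self ENNReal.one_ne_top one_ne_zero hcpos.ne'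
    exact absurd (h1 ▸ hBle) (not_le.2 hlt)
  have : ∀ᵐ y ∂μ, ¬ BddAbove (Set.range fun n : ℕ => ∑ i ∈ Finset.range n, -Y (y i)) := by
    rw [ae_iff]; simpa using hB0
  filter_upwards [this] with y hy a
  obtain ⟨_, ⟨n, rfl⟩, hn⟩ := not_bddAbove_iff.1 hy a
  exact ⟨n, by rw [← Finset.sum_neg_distrib]; exact hn⟩

/-- Perturbations whose positive part is not integrable exceed every linear function infinitely
often. -/
theorem ae_unbounded_of_not_integrable {Y L : S → ℝ} (hY : Measurable Y) (hL : Measurable L)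
    (hint : Integrable Y Q) (hLint : ∫⁻ s, ENNReal.ofReal (L s) ∂Q = ∞) :
    ∀ᵐ y ∂(Measure.infinitePi fun _ : ℕ => Q), ∀ a : ℝ, ∃ k : ℕ,
      a < L (y k) - ∑ i ∈ Finset.range k, Y (y i) := by
  set κ := ∫ s, Y s ∂Q with hκ
  set C : ℝ := |κ| + 2 with hC
  have hC0 : 0 < C := by positivity
  have hQ : ∑' k : ℕ, Q {s | C * k < L s} = ∞ := by
    have hmeas : ∀ k : ℕ, MeasurableSet {s | C * k < L s} := fun k =>
      measurableSet_lt measurable_const hL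
    have hpt : ∀ s, ENNReal.ofReal (L s)
        ≤ ENNReal.ofReal C * ∑' k : ℕ, Set.indicator {s | C * k < L s} 1 s := by
      intro s
      have h1 : ((⌈L s / C⌉₊ : ℕ) : ℝ≥0∞) ≤ ∑' k : ℕ, Set.indicator {s | C * k < L s} 1 s := by
        refine le_trans ?_ (ENNReal.sum_le_tsum (Finset.range ⌈L s / C⌉₊))
        have : ∀ k ∈ Finset.range ⌈L s / C⌉₊,
            Set.indicator {s | C * k < L s} (1 : S → ℝ≥0∞) s = 1 := by
          intro k hk
          rw [Finset.mem_range, Nat.lt_ceil, lt_div_iff₀ hC0] at hk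
          rw [Set.indicator_of_mem]
          · rfl
          · simp only [Set.mem_ofPred_eq]; linarith
        rw [Finset.sum_congr rfl this]; simp
      refine le_trans ?_ (mul_le_mul_right h1 _)
      rw [← ENNReal.ofReal_natCast, ← ENNReal.ofReal_mul hC0.le]
      refine ENNReal.ofReal_le_ofReal ?_
      have := Nat.le_ceil (L s / C)
      rw [div_le_iff₀ hC0] at this
      linarith
    have h2 : ∞ ≤ ENNReal.ofReal C * ∑' k : ℕ, Q {s | C * k < L s} := by
      rw [← hLint]
      refine (lintegral_mono hpt).trans ?_
      rw [lintegral_const_mul' _ _ ENNReal.ofReal_ne_top, lintegral_tsum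
        fun k => (measurable_one.indicator (hmeas k)).aemeasurable]
      simp_rw [lintegral_indicator_one (hmeas _)]
      rfl
    by_contra hne
    exact (ENNReal.mul_lt_top ENNReal.ofReal_lt_top (lt_top_iff_ne_top.2 hne)).ne (top_le_iff.1 h2)
  have hio : ∀ᵐ y ∂(Measure.infinitePi fun _ : ℕ => Q),
      ∃ᶠ k : ℕ in atTop, C * k < L (y k) := by
    have hmeas : ∀ k : ℕ, MeasurableSet {y : ℕ → S | C * k < L (y k)} := fun k =>
      measurableSet_lt measurable_const (hL.comp (measurable_pi_apply k))
    have hind : iIndepSet (fun k : ℕ => {y : ℕ → S | C * k < L (y k)})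
        (Measure.infinitePi fun _ : ℕ => Q) := by
      have := iIndepFun_coord Q hL
      rw [iIndepSet_iff_meas_biInter hmeas]
      intro s
      exact this.meas_biInter (S := s) (fun k _ => ⟨Set.Ioi (C * k), measurableSet_Ioi, rfl⟩)
    have h1 := measure_limsup_eq_one hmeas hind (by
      rw [← hQ]
      refine tsum_congr fun k => ?_
      exact (measurePreserving_eval_infinitePi (fun _ : ℕ => Q) k).measure_preimage
        (measurableSet_lt measurable_const hL).nullMeasurableSet)
    have h2 : ∀ᵐ y ∂(Measure.infinitePi fun _ : ℕ => Q),
        y ∈ limsup (fun k : ℕ => {y : ℕ → S | C * k < L (y k)}) atTop :=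
      (prob_compl_eq_zero_iff (MeasurableSet.measurableSet_limsup hmeas)).2 h1
    filter_upwards [h2] with y hy
    rw [limsup_eq_iInf_iSup_of_nat] at hy
    simpa [frequently_atTop] using hy
  filter_upwards [ae_tendsto_walk_div Q hY hint, hio] with y h1 h2 a
  have h3 : ∀ᶠ n : ℕ in atTop, (∑ i ∈ Finset.range n, Y (y i)) / n < κ + 1 :=
    h1.eventually_lt_const (by linarith)
  obtain ⟨k, hk, hk1, hk2, hk3⟩ := (h2.and_eventually (h3.and
    ((tendsto_natCast_atTop_atTop (R := ℝ)).eventually_gt_atTop a |>.and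
      (eventually_gt_atTop 0)))).exists
  have hk' : (0 : ℝ) < k := by exact_mod_cast hk3
  rw [div_lt_iff₀ hk'] at hk1
  refine ⟨k, ?_⟩
  have : κ ≤ |κ| := le_abs_self κ
  nlinarith

end Walk

/-! ### The tilted law of a typical child -/

open Classical in
/-- The exponential weight of the `i`-th child in a point configuration, zero if there is no such
child. -/
noncomputable def childWeight (θ : ℝ) (c : PointConfig) (i : ℕ) : ℝ≥0∞ :=
  if (i : ℕ∞) < c.1 then ENNReal.ofReal (Real.exp (-θ * c.2 i)) else 0

theorem atomSum_eq_tsum (θ : ℝ) (c : PointConfig) : atomSum θ c = ∑' i, childWeight θ c i := rfl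

theorem measurable_atom (i : ℕ) : Measurable fun c : PointConfig => c.2 i :=
  (measurable_pi_apply i).comp measurable_snd

theorem measurable_atom_prod : Measurable fun p : PointConfig × ℕ => p.1.2 p.2 :=
  measurable_from_prod_countable_left measurable_atom

theorem measurable_exp_atom (t : ℝ) :
    Measurable fun p : PointConfig × ℕ => Real.exp (t * -(p.1.2 p.2)) :=
  (measurable_atom_prod.neg.const_mul t).exp

theorem measurableSet_isAtom : MeasurableSet {p : PointConfig × ℕ | (p.2 : ℕ∞) < p.1.1} := by
  have : Measurable fun p : PointConfig × ℕ => (p.1.1, p.2) := by fun_prop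
  exact this (MeasurableSet.of_discrete (s := {q : ℕ∞ × ℕ | (q.2 : ℕ∞) < q.1}))

@[fun_prop]
theorem measurable_childWeight (θ : ℝ) (i : ℕ) : Measurable fun c => childWeight θ c i := by
  have h : MeasurableSet {c : PointConfig | (i : ℕ∞) < c.1} :=
    measurable_fst (MeasurableSet.of_discrete (s := {n : ℕ∞ | (i : ℕ∞) < n}))
  unfold childWeight
  refine Measurable.ite h ?_ measurable_const
  exact ((measurable_atom i).const_mul (-θ)).exp.ennreal_ofReal

@[fun_prop]
theorem measurable_atomSum (θ : ℝ) : Measurable (atomSum θ) :=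
  Measurable.tsum fun i => measurable_childWeight θ i

section Tilt

set_option linter.unusedSectionVars false

variable {Θ : Type*} [MeasurableSpace Θ] (ν : Measure Θ) [IsProbabilityMeasure ν]
  (η : Kernel Θ PointConfig) [IsMarkovKernel η] (θ : ℝ)


/-- The intensity of the atoms of the offspring configuration, as a kernel from the environment
states to the pairs of a configuration and the index of one of its atoms. -/
noncomputable def atomKernel : Kernel Θ (PointConfig × ℕ) :=
  (η ×ₖ Kernel.const Θ Measure.count).restrict measurableSet_isAtom

instance : IsSFiniteKernel (atomKernel η) := by unfold atomKernel; infer_instance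

/-- The normalized weight of a child in a given environment state. -/
noncomputable def tiltDensity (s : Θ × PointConfig × ℕ) : ℝ≥0∞ :=
  ENNReal.ofReal (Real.exp (-θ * s.2.1.2 s.2.2)) / laplaceMean η s.1 θ

/-- The law of a child picked with probability proportional to its weight, jointly with its
environment state and its family of siblings; the family is then size-biased. -/
noncomputable def tiltLaw : Measure (Θ × PointConfig × ℕ) :=
  (ν ⊗ₘ atomKernel η).withDensity (tiltDensity η θ)

/-- The total normalized weight of a family in a given environment state. -/
noncomputable def familyMass (e : Θ) (c : PointConfig) : ℝ≥0∞ := atomSum θ c / laplaceMean η e θ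

/-- The increment of the tilted random walk: minus the logarithm of the normalized weight. -/
noncomputable def tiltStep (s : Θ × PointConfig × ℕ) : ℝ :=
  θ * s.2.1.2 s.2.2 + Real.log (laplaceMean η s.1 θ).toReal

@[fun_prop]
theorem measurable_laplaceMean : Measurable fun e => laplaceMean η e θ :=
  (measurable_atomSum θ).lintegral_kernel

theorem measurable_position_atom :
    Measurable fun s : Θ × PointConfig × ℕ => s.2.1.2 s.2.2 :=
  measurable_atom_prod.comp measurable_snd

@[fun_prop]
theorem measurable_tiltDensity : Measurable (tiltDensity η θ) :=
  ((measurable_position_atom.const_mul (-θ)).exp.ennreal_ofReal).div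
    ((measurable_laplaceMean η θ).comp measurable_fst)

@[fun_prop]
theorem measurable_familyMass : Measurable fun p : Θ × PointConfig => familyMass η θ p.1 p.2 :=
  ((measurable_atomSum θ).comp measurable_snd).div
    ((measurable_laplaceMean η θ).comp measurable_fst)

theorem measurable_familyMass_right (e : Θ) : Measurable (familyMass η θ e) :=
  (measurable_atomSum θ).div_const _

theorem measurable_tiltStep : Measurable (tiltStep η θ) :=
  (measurable_position_atom.const_mul θ).add
    ((measurable_laplaceMean η θ).comp measurable_fst).ennreal_toReal.log

open Classical in
theorem lintegral_atomKernel (e : Θ) {F : PointConfig × ℕ → ℝ≥0∞} (hF : Measurable F) :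
    ∫⁻ p, F p ∂(atomKernel η e)
      = ∫⁻ c, ∑' i : ℕ, (if (i : ℕ∞) < c.1 then F (c, i) else 0) ∂(η e) := by
  rw [atomKernel, Kernel.lintegral_restrict, ← lintegral_indicator measurableSet_isAtom,
    Kernel.lintegral_prod _ _ _ (hF.indicator measurableSet_isAtom)]
  refine lintegral_congr fun c => ?_
  rw [Kernel.lintegral_const, lintegral_count]
  refine tsum_congr fun i => ?_
  simp [Set.indicator_apply]

theorem laplaceMean_eq_lintegral (e : Θ) (t : ℝ) :
    laplaceMean η e t
      = ∫⁻ p, ENNReal.ofReal (Real.exp (t * -(p.1.2 p.2))) ∂(atomKernel η e) := by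
  rw [lintegral_atomKernel η e (measurable_exp_atom t).ennreal_ofReal]
  simp [laplaceMean, atomSum]

theorem mgf_atomKernel (e : Θ) (t : ℝ) :
    mgf (fun p : PointConfig × ℕ => -(p.1.2 p.2)) (atomKernel η e) t
      = (laplaceMean η e t).toReal := by
  rw [mgf, integral_eq_lintegral_of_nonneg_ae (ae_of_all _ fun _ => (Real.exp_pos _).le)
    (measurable_exp_atom t).aestronglyMeasurable, laplaceMean_eq_lintegral]

theorem mem_integrableExpSet_atomKernel {e : Θ} {t : ℝ} (h : laplaceMean η e t < ∞) :
    t ∈ integrableExpSet (fun p : PointConfig × ℕ => -(p.1.2 p.2)) (atomKernel η e) := by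
  refine ⟨(measurable_exp_atom t).aestronglyMeasurable, ?_⟩
  rw [hasFiniteIntegral_iff_ofReal (ae_of_all _ fun _ => (Real.exp_pos _).le)]
  rwa [laplaceMean_eq_lintegral] at h

theorem finiteDomain_subset :
    finiteDomain ν η ⊆ integrableExpSet (fun s : Θ × PointConfig × ℕ => -(s.2.1.2 s.2.2))
      (ν ⊗ₘ atomKernel η) := by
  intro t ht
  have hm : Measurable fun s : Θ × PointConfig × ℕ => Real.exp (t * -(s.2.1.2 s.2.2)) :=
    (measurable_exp_atom t).comp measurable_snd
  refine ⟨hm.aestronglyMeasurable, ?_⟩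
  rw [hasFiniteIntegral_iff_ofReal (ae_of_all _ fun _ => (Real.exp_pos _).le),
    Measure.lintegral_compProd hm.ennreal_ofReal]
  simp_rw [← laplaceMean_eq_lintegral]
  exact ht

theorem lintegral_tiltLaw {F : Θ × PointConfig × ℕ → ℝ≥0∞} (hF : Measurable F) :
    ∫⁻ s, F s ∂(tiltLaw ν η θ)
      = ∫⁻ e, ∫⁻ c, ∑' i : ℕ, childWeight θ c i / laplaceMean η e θ * F (e, c, i) ∂(η e) ∂ν := by
  rw [tiltLaw, lintegral_withDensity_eq_lintegral_mul _ (measurable_tiltDensity η θ) hF,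
    Measure.lintegral_compProd ((measurable_tiltDensity η θ).mul hF)]
  refine lintegral_congr fun e => ?_
  rw [lintegral_atomKernel η e (F := fun p => (tiltDensity η θ * F) (e, p))
    (((measurable_tiltDensity η θ).mul hF).comp measurable_prodMk_left)]
  refine lintegral_congr fun c => tsum_congr fun i => ?_
  by_cases h : (i : ℕ∞) < c.1 <;> simp [childWeight, tiltDensity, h]

/-- For functions of the family alone, tilting amounts to size-biasing by the total normalized
weight. -/
theorem lintegral_tiltLaw_family {F : Θ × PointConfig → ℝ≥0∞} (hF : Measurable F) :
    ∫⁻ s, F (s.1, s.2.1) ∂(tiltLaw ν η θ)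
      = ∫⁻ e, ∫⁻ c, familyMass η θ e c * F (e, c) ∂(η e) ∂ν := by
  rw [lintegral_tiltLaw ν η θ (F := fun s => F (s.1, s.2.1)) (by fun_prop)]
  refine lintegral_congr fun e => lintegral_congr fun c => ?_
  simp_rw [ENNReal.tsum_mul_right, div_eq_mul_inv, ENNReal.tsum_mul_right]
  rw [familyMass, atomSum_eq_tsum, div_eq_mul_inv]

theorem lintegral_familyMass {e : Θ} (h0 : laplaceMean η e θ ≠ 0) (h1 : laplaceMean η e θ ≠ ∞) :
    ∫⁻ c, familyMass η θ e c ∂(η e) = 1 := by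
  simp_rw [familyMass, div_eq_mul_inv]
  rw [lintegral_mul_const _ (measurable_atomSum θ)]
  exact ENNReal.mul_inv_cancel h0 h1

variable {ν η θ}

theorem ae_laplaceMean_lt_top {t : ℝ} (ht : t ∈ finiteDomain ν η) :
    ∀ᵐ e ∂ν, laplaceMean η e t < ∞ :=
  ae_lt_top (measurable_laplaceMean η t) (ne_of_lt ht)

theorem map_fst_tiltLaw (hm : ∀ᵐ e ∂ν, laplaceMean η e θ ≠ 0 ∧ laplaceMean η e θ ≠ ∞) :
    (tiltLaw ν η θ).map Prod.fst = ν := by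
  ext A hA
  rw [← lintegral_indicator_one hA, ← lintegral_indicator_one hA,
    lintegral_map (measurable_one.indicator hA) measurable_fst]
  rw [lintegral_tiltLaw_family ν η θ (F := fun p => A.indicator 1 p.1)
    ((measurable_one.indicator hA).comp measurable_fst)]
  refine lintegral_congr_ae ?_
  filter_upwards [hm] with e he
  rw [lintegral_mul_const _ (measurable_familyMass_right η θ e),
    lintegral_familyMass η θ he.1 he.2, one_mul]

theorem isProbabilityMeasure_tiltLaw
    (hm : ∀ᵐ e ∂ν, laplaceMean η e θ ≠ 0 ∧ laplaceMean η e θ ≠ ∞) :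
    IsProbabilityMeasure (tiltLaw ν η θ) := by
  refine ⟨?_⟩
  have := congrArg (fun μ => μ Set.univ) (map_fst_tiltLaw hm)
  simpa [Measure.map_apply measurable_fst MeasurableSet.univ] using this

theorem ae_atomLaw_of_ae {p : Θ → Prop} (hp : ∀ᵐ e ∂ν, p e) :
    ∀ᵐ s ∂(ν ⊗ₘ atomKernel η), p s.1 := by
  obtain ⟨A, hA, hAm, hAp⟩ := hp.exists_measurable_mem
  exact (Measure.ae_compProd_of_ae_fst (p := fun e => e ∈ A) _ hAm hA).mono
    fun s hs => hAp _ hs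

theorem ae_tiltLaw_of_ae {p : Θ → Prop} (hp : ∀ᵐ e ∂ν, p e) :
    ∀ᵐ s ∂(tiltLaw ν η θ), p s.1 :=
  (withDensity_absolutelyContinuous _ _).ae_le (ae_atomLaw_of_ae hp)

theorem tiltDensity_eq_exp {s : Θ × PointConfig × ℕ} (h0 : laplaceMean η s.1 θ ≠ 0)
    (h1 : laplaceMean η s.1 θ ≠ ∞) :
    tiltDensity η θ s = ENNReal.ofReal (Real.exp (-tiltStep η θ s)) := by
  have hpos : 0 < (laplaceMean η s.1 θ).toReal := ENNReal.toReal_pos h0 h1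
  rw [tiltDensity, tiltStep, neg_add, Real.exp_add, ← neg_mul, Real.exp_neg (Real.log _),
    Real.exp_log hpos, ENNReal.ofReal_mul (Real.exp_pos _).le, ENNReal.ofReal_inv_of_pos hpos,
    ENNReal.ofReal_toReal h1, div_eq_mul_inv]

/-- A child contributes at most the total weight of its family, which is finite. -/
theorem ae_neg_tiltStep_le (hm : ∀ᵐ e ∂ν, laplaceMean η e θ ≠ 0 ∧ laplaceMean η e θ ≠ ∞) :
    ∀ᵐ s ∂(tiltLaw ν η θ), familyMass η θ s.1 s.2.1 ≠ ∞ ∧ familyMass η θ s.1 s.2.1 ≠ 0 ∧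
      -tiltStep η θ s ≤ Real.log (familyMass η θ s.1 s.2.1).toReal := by
  have hfin : ∀ᵐ s ∂(tiltLaw ν η θ), familyMass η θ s.1 s.2.1 ≠ ∞ := by
    have hA : MeasurableSet {p : Θ × PointConfig | familyMass η θ p.1 p.2 = ∞} :=
      measurable_familyMass η θ (measurableSet_singleton ∞)
    have hA' : MeasurableSet {s : Θ × PointConfig × ℕ | familyMass η θ s.1 s.2.1 = ∞} :=
      (by fun_prop : Measurable fun s : Θ × PointConfig × ℕ => (s.1, s.2.1)) hA
    simp only [ae_iff, not_not]
    rw [← lintegral_indicator_one hA']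
    have h := lintegral_tiltLaw_family ν η θ (F := Set.indicator
      {p : Θ × PointConfig | familyMass η θ p.1 p.2 = ∞} 1) (measurable_one.indicator hA)
    refine Eq.trans ?_ (h.trans ?_)
    · rfl
    · rw [← lintegral_zero (μ := ν)]
      refine lintegral_congr_ae ?_
      filter_upwards [hm] with e he
      rw [← lintegral_zero (μ := η e)]
      have hlt := ae_lt_top (measurable_familyMass_right η θ e)
        (μ := η e) (by
          rw [lintegral_familyMass η θ he.1 he.2]; exact ENNReal.one_ne_top)
      refine lintegral_congr_ae ?_
      filter_upwards [hlt] with c hc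
      simp [hc.ne]
  have hatom : ∀ᵐ s ∂(tiltLaw ν η θ), (s.2.2 : ℕ∞) < s.2.1.1 := by
    refine (withDensity_absolutelyContinuous _ _).ae_le ?_
    refine (Measure.ae_compProd_iff (measurable_snd measurableSet_isAtom)).2
      (ae_of_all _ fun e => ?_)
    rw [atomKernel, Kernel.restrict_apply]
    exact ae_restrict_mem measurableSet_isAtom
  filter_upwards [hfin, hatom, ae_tiltLaw_of_ae hm] with s h1 h2 h3
  have hle : tiltDensity η θ s ≤ familyMass η θ s.1 s.2.1 := by
    refine ENNReal.div_le_div_right ?_ _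
    rw [atomSum_eq_tsum]
    refine le_trans (le_of_eq ?_) (ENNReal.le_tsum s.2.2)
    rw [childWeight, if_pos h2]
  rw [tiltDensity_eq_exp h3.1 h3.2] at hle
  have hne : familyMass η θ s.1 s.2.1 ≠ 0 := by
    intro h
    rw [h, nonpos_iff_eq_zero, ENNReal.ofReal_eq_zero] at hle
    exact absurd (Real.exp_pos _) (not_lt.2 hle)
  refine ⟨h1, hne, ?_⟩
  rw [ENNReal.ofReal_le_iff_le_toReal h1] at hle
  rw [← Real.log_exp (-tiltStep η θ s)]
  exact Real.log_le_log (Real.exp_pos _) hle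

end Tilt

/-! ### Moments of the tilted step -/

section Moments

set_option linter.unusedSectionVars false

variable {Θ : Type*} [MeasurableSpace Θ] {ν : Measure Θ} [IsProbabilityMeasure ν]
  {η : Kernel Θ PointConfig} [IsMarkovKernel η] {θ : ℝ} {δ : ℝ≥0∞}

theorem ae_laplaceMean_ne (hθ : θ ∈ interior (finiteDomain ν η))
    (hell : ∀ᵐ e ∂ν, δ < laplaceMean η e θ) :
    ∀ᵐ e ∂ν, laplaceMean η e θ ≠ 0 ∧ laplaceMean η e θ ≠ ∞ := by
  filter_upwards [hell, ae_laplaceMean_lt_top (interior_subset hθ)] with e h1 h2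
  exact ⟨(pos_of_gt h1).ne', h2.ne⟩

/-- The ellipticity constant, as a positive real number. -/
theorem exists_pos_le_laplaceMean (hθ : θ ∈ interior (finiteDomain ν η)) (hδ : 0 < δ)
    (hell : ∀ᵐ e ∂ν, δ < laplaceMean η e θ) :
    ∃ r : ℝ, 0 < r ∧ ∀ᵐ e ∂ν, r ≤ (laplaceMean η e θ).toReal := by
  obtain ⟨e, he⟩ := hell.exists
  refine ⟨δ.toReal, ENNReal.toReal_pos hδ.ne' (ne_top_of_lt he), ?_⟩
  filter_upwards [hell, ae_laplaceMean_ne hθ hell] with e h1 h2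
  exact ENNReal.toReal_mono h2.2 h1.le

theorem ae_mem_interior_integrableExpSet (hθ : θ ∈ interior (finiteDomain ν η)) :
    ∀ᵐ e ∂ν, θ ∈ interior
      (integrableExpSet (fun p : PointConfig × ℕ => -(p.1.2 p.2)) (atomKernel η e)) := by
  obtain ⟨ε, hε, hball⟩ := Metric.mem_nhds_iff.1 (mem_interior_iff_mem_nhds.1 hθ)
  have h1 : θ - ε / 2 ∈ finiteDomain ν η := hball (by
    rw [Metric.mem_ball, Real.dist_eq, abs_lt]; constructor <;> linarith)
  have h2 : θ + ε / 2 ∈ finiteDomain ν η := hball (by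
    rw [Metric.mem_ball, Real.dist_eq, abs_lt]; constructor <;> linarith)
  filter_upwards [ae_laplaceMean_lt_top h1, ae_laplaceMean_lt_top h2] with e he1 he2
  refine mem_interior.2 ⟨Set.Ioo (θ - ε / 2) (θ + ε / 2), ?_, isOpen_Ioo,
    by constructor <;> linarith⟩
  exact Set.Ioo_subset_Icc_self.trans (convex_integrableExpSet.ordConnected.out
    (mem_integrableExpSet_atomKernel η he1) (mem_integrableExpSet_atomKernel η he2))

theorem ae_hasDerivAt_laplaceMean (hθ : θ ∈ interior (finiteDomain ν η)) :
    ∀ᵐ e ∂ν, HasDerivAt (fun t => (laplaceMean η e t).toReal)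
      (∫ p, -(p.1.2 p.2) * Real.exp (-θ * p.1.2 p.2) ∂(atomKernel η e)) θ := by
  filter_upwards [ae_mem_interior_integrableExpSet hθ] with e he
  have := hasDerivAt_mgf he
  simp only [mul_neg, ← neg_mul θ] at this
  rwa [show mgf (fun p : PointConfig × ℕ => -(p.1.2 p.2)) (atomKernel η e)
    = fun t => (laplaceMean η e t).toReal from funext fun t => mgf_atomKernel η e t] at this

theorem tiltDensity_toReal (s : Θ × PointConfig × ℕ) :
    (tiltDensity η θ s).toReal
      = Real.exp (-θ * s.2.1.2 s.2.2) / (laplaceMean η s.1 θ).toReal := by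
  rw [tiltDensity, ENNReal.toReal_div, ENNReal.toReal_ofReal (Real.exp_pos _).le]

theorem ae_tiltDensity_lt_top (hm : ∀ᵐ e ∂ν, laplaceMean η e θ ≠ 0 ∧ laplaceMean η e θ ≠ ∞) :
    ∀ᵐ s ∂(ν ⊗ₘ atomKernel η), tiltDensity η θ s < ∞ := by
  filter_upwards [ae_atomLaw_of_ae hm] with s hs
  exact ENNReal.div_lt_top ENNReal.ofReal_ne_top hs.1

/-- The displacement of the picked child has moments of all orders, as `θ` is an interior point
of the domain of the annealed Laplace transform. -/
theorem integrable_abs_pow_position (hθ : θ ∈ interior (finiteDomain ν η)) (hδ : 0 < δ)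
    (hell : ∀ᵐ e ∂ν, δ < laplaceMean η e θ) (n : ℕ) :
    Integrable (fun s : Θ × PointConfig × ℕ => |s.2.1.2 s.2.2| ^ n) (tiltLaw ν η θ) := by
  obtain ⟨r, hr, hrm⟩ := exists_pos_le_laplaceMean hθ hδ hell
  rw [tiltLaw, integrable_withDensity_iff_integrable_smul' (measurable_tiltDensity η θ)
    (ae_tiltDensity_lt_top (ae_laplaceMean_ne hθ hell))]
  have hint := (integrable_pow_abs_mul_exp_of_mem_interior_integrableExpSet
    (interior_mono (finiteDomain_subset ν η) hθ) n).const_mul r⁻¹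
  refine hint.mono' ?_ ?_
  · exact ((measurable_tiltDensity η θ).ennreal_toReal.smul
      ((measurable_position_atom).norm.pow_const n)).aestronglyMeasurable
  · filter_upwards [ae_atomLaw_of_ae hrm] with s hs
    rw [tiltDensity_toReal, smul_eq_mul, Real.norm_of_nonneg (by positivity), abs_neg, mul_neg,
      ← neg_mul θ, div_mul_eq_mul_div, div_eq_inv_mul, mul_comm (Real.exp _)]
    gcongr

theorem memLp_log_laplaceMean (hθ : θ ∈ interior (finiteDomain ν η)) (hδ : 0 < δ)
    (hell : ∀ᵐ e ∂ν, δ < laplaceMean η e θ) :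
    MemLp (fun e => Real.log (laplaceMean η e θ).toReal) 2 ν := by
  obtain ⟨r, hr, hrm⟩ := exists_pos_le_laplaceMean hθ hδ hell
  have hmeas := (measurable_laplaceMean η θ).ennreal_toReal
  rw [memLp_two_iff_integrable_sq hmeas.log.aestronglyMeasurable]
  have hint : Integrable (fun e => (laplaceMean η e θ).toReal) ν :=
    integrable_toReal_of_lintegral_ne_top (measurable_laplaceMean η θ).aemeasurable
      (ne_of_lt (interior_subset hθ : θ ∈ finiteDomain ν η))
  refine ((hint.const_mul 4).add (integrable_const (Real.log r ^ 2))).mono'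
    (hmeas.log.pow_const 2).aestronglyMeasurable ?_
  filter_upwards [hrm] with e he
  rw [Real.norm_of_nonneg (sq_nonneg _), Pi.add_apply]
  set x := (laplaceMean η e θ).toReal
  have hx : 0 < x := hr.trans_le he
  rcases le_total 1 x with h1 | h1
  · have h2 : Real.log x ≤ 2 * √x := by
      have h3 := Real.log_le_sub_one_of_pos (Real.sqrt_pos.2 hx)
      rw [Real.log_sqrt hx.le] at h3
      linarith
    have h4 : Real.log x ^ 2 ≤ (2 * √x) ^ 2 := pow_le_pow_left₀ (Real.log_nonneg h1) h2 2
    rw [mul_pow, Real.sq_sqrt hx.le] at h4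
    nlinarith [sq_nonneg (Real.log r)]
  · have h2 : Real.log r ≤ Real.log x := Real.log_le_log hr he
    have h3 : Real.log x ≤ 0 := Real.log_nonpos hx.le h1
    nlinarith

theorem memLp_log_laplaceMean_tiltLaw (hθ : θ ∈ interior (finiteDomain ν η)) (hδ : 0 < δ)
    (hell : ∀ᵐ e ∂ν, δ < laplaceMean η e θ) :
    MemLp (fun s : Θ × PointConfig × ℕ => Real.log (laplaceMean η s.1 θ).toReal) 2
      (tiltLaw ν η θ) := by
  have h := memLp_log_laplaceMean hθ hδ hell
  rw [← map_fst_tiltLaw (ae_laplaceMean_ne hθ hell)] at h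
  exact h.comp_of_map measurable_fst.aemeasurable

theorem memLp_position (hθ : θ ∈ interior (finiteDomain ν η)) (hδ : 0 < δ)
    (hell : ∀ᵐ e ∂ν, δ < laplaceMean η e θ) :
    MemLp (fun s : Θ × PointConfig × ℕ => s.2.1.2 s.2.2) 2 (tiltLaw ν η θ) := by
  rw [memLp_two_iff_integrable_sq measurable_position_atom.aestronglyMeasurable]
  simpa using integrable_abs_pow_position hθ hδ hell 2

theorem memLp_tiltStep (hθ : θ ∈ interior (finiteDomain ν η)) (hδ : 0 < δ)
    (hell : ∀ᵐ e ∂ν, δ < laplaceMean η e θ) :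
    MemLp (tiltStep η θ) 2 (tiltLaw ν η θ) :=
  ((memLp_position hθ hδ hell).const_mul θ).add (memLp_log_laplaceMean_tiltLaw hθ hδ hell)

/-- The quantity `κ` is the drift of the tilted random walk. -/
theorem integrable_kappaIntegrand_and_integral_eq (hθ : θ ∈ interior (finiteDomain ν η))
    (hδ : 0 < δ) (hell : ∀ᵐ e ∂ν, δ < laplaceMean η e θ) :
    Integrable (kappaIntegrand η θ) ν ∧
      ∫ e, kappaIntegrand η θ e ∂ν = ∫ s, tiltStep η θ s ∂(tiltLaw ν η θ) := by
  have hm := ae_laplaceMean_ne hθ hell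
  have : IsProbabilityMeasure (tiltLaw ν η θ) := isProbabilityMeasure_tiltLaw hm
  have hlog := (memLp_log_laplaceMean hθ hδ hell).integrable one_le_two
  have hlogQ := (memLp_log_laplaceMean_tiltLaw hθ hδ hell).integrable one_le_two
  have hposQ := (memLp_position hθ hδ hell).integrable one_le_two
  have hlt := ae_tiltDensity_lt_top hm
  have hpos : Integrable (fun s : Θ × PointConfig × ℕ =>
      (tiltDensity η θ s).toReal • s.2.1.2 s.2.2) (ν ⊗ₘ atomKernel η) :=
    (integrable_withDensity_iff_integrable_smul' (measurable_tiltDensity η θ) hlt).1 hposQ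
  have hinner : (fun e => ∫ p, (tiltDensity η θ (e, p)).toReal • p.1.2 p.2 ∂(atomKernel η e))
      =ᵐ[ν] fun e => -(deriv (fun t => (laplaceMean η e t).toReal) θ
        / (laplaceMean η e θ).toReal) := by
    filter_upwards [ae_hasDerivAt_laplaceMean hθ] with e he
    rw [he.deriv, ← neg_div, ← integral_neg, ← integral_div]
    refine integral_congr_ae (ae_of_all _ fun p => ?_)
    simp only [tiltDensity_toReal, smul_eq_mul]
    ring
  have hint1 : Integrable (fun e => -(deriv (fun t => (laplaceMean η e t).toReal) θ
      / (laplaceMean η e θ).toReal)) ν := Integrable.congr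
    (Integrable.integral_compProd (κ := Kernel.const Unit ν)
      (η := Kernel.prodMkLeft Unit (atomKernel η)) (a := ()) hpos) hinner
  have heq : kappaIntegrand η θ = fun e => θ * -(deriv (fun t => (laplaceMean η e t).toReal) θ
      / (laplaceMean η e θ).toReal) + Real.log (laplaceMean η e θ).toReal := by
    funext e; rw [kappaIntegrand]; ring
  refine ⟨heq ▸ (hint1.const_mul θ).add hlog, ?_⟩
  have e1 : ∫ s, s.2.1.2 s.2.2 ∂(tiltLaw ν η θ)
      = ∫ e, -(deriv (fun t => (laplaceMean η e t).toReal) θ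
        / (laplaceMean η e θ).toReal) ∂ν := by
    rw [tiltLaw, integral_withDensity_eq_integral_toReal_smul (measurable_tiltDensity η θ) hlt,
      Measure.integral_compProd hpos]
    exact integral_congr_ae hinner
  have e2 : ∫ s, Real.log (laplaceMean η s.1 θ).toReal ∂(tiltLaw ν η θ)
      = ∫ e, Real.log (laplaceMean η e θ).toReal ∂ν := by
    have h := integral_map (μ := tiltLaw ν η θ) measurable_fst.aemeasurable
      (f := fun e => Real.log (laplaceMean η e θ).toReal)
      (measurable_laplaceMean η θ).ennreal_toReal.log.aestronglyMeasurable
    rw [map_fst_tiltLaw hm] at h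
    exact h.symm
  rw [heq, integral_add (hint1.const_mul θ) hlog, integral_const_mul, ← e1, ← e2,
    ← integral_const_mul, ← integral_add (hposQ.const_mul θ) hlogQ]
  rfl

theorem toENNReal_eq_tsum (n : ℕ∞) :
    (n : ℝ≥0∞) = ∑' i : ℕ, (if (i : ℕ∞) < n then 1 else 0 : ℝ≥0∞) := by
  induction n with
  | top => simp
  | coe n =>
    rw [tsum_eq_sum (s := Finset.range n) (by simp)]
    rw [Finset.sum_congr rfl (g := fun _ => (1 : ℝ≥0∞)) (by simp +contextual)]
    simp

/-- The tilted walk does not stand still: otherwise all the children of a family would have the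
same normalized weight one, and the mean offspring number would be one. -/
theorem not_ae_tiltStep_eq_zero (hpos : PosMeanLogOffspring ν η)
    (hm : ∀ᵐ e ∂ν, laplaceMean η e θ ≠ 0 ∧ laplaceMean η e θ ≠ ∞) :
    ¬ ∀ᵐ s ∂(tiltLaw ν η θ), tiltStep η θ s = 0 := by
  intro h
  have h1 : ∀ᵐ s ∂(ν ⊗ₘ atomKernel η), tiltStep η θ s = 0 := by
    refine (withDensity_absolutelyContinuous' (measurable_tiltDensity η θ).aemeasurable
      ?_).ae_le h
    filter_upwards [ae_atomLaw_of_ae hm] with s hs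
    refine (ENNReal.div_pos ?_ hs.2).ne'
    exact (ENNReal.ofReal_pos.2 (Real.exp_pos _)).ne'
  have h2 : ∀ᵐ e ∂ν, meanOffspring η e = 1 := by
    filter_upwards [Measure.ae_ae_of_ae_compProd h1, hm] with e he hme
    have hconst : laplaceMean η e θ = laplaceMean η e θ * meanOffspring η e := by
      conv_lhs => rw [laplaceMean_eq_lintegral]
      rw [lintegral_congr_ae (g := fun _ => laplaceMean η e θ)]
      · have hN : atomKernel η e Set.univ = meanOffspring η e := by
          rw [← lintegral_one, lintegral_atomKernel η e measurable_const, meanOffspring]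
          simp_rw [toENNReal_eq_tsum]
        rw [lintegral_const, hN]
      · filter_upwards [he] with p hp
        have h3 := tiltDensity_eq_exp (η := η) (θ := θ) (s := (e, p)) hme.1 hme.2
        rw [hp, neg_zero, Real.exp_zero, ENNReal.ofReal_one, tiltDensity,
          ENNReal.div_eq_one_iff hme.1 hme.2] at h3
        simpa using h3
    conv_lhs at hconst => rw [← mul_one (laplaceMean η e θ)]
    exact ((ENNReal.mul_right_inj hme.1 hme.2).1 hconst).symm
  have h3 : ∫⁻ e, (ENNReal.log (meanOffspring η e)).toENNReal ∂ν = 0 := by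
    rw [← lintegral_zero (μ := ν)]
    refine lintegral_congr_ae ?_
    filter_upwards [h2] with e he
    simp [he]
  rw [PosMeanLogOffspring, h3] at hpos
  exact absurd hpos not_lt_zero

/-- The `X log X` condition, in terms of the size-biased family. -/
theorem lintegral_log_familyMass_lt_top_iff :
    ∫⁻ s, ENNReal.ofReal (Real.log (familyMass η θ s.1 s.2.1).toReal) ∂(tiltLaw ν η θ) < ∞ ↔
      ∫⁻ e, ∫⁻ c, ENNReal.ofReal ((familyMass η θ e c).toReal
        * |Real.log (familyMass η θ e c).toReal|) ∂(η e) ∂ν < ∞ := by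
  -- at `x = ∞` both sides vanish, as `ENNReal.toReal` sends `∞` to zero
  have hpt : ∀ x : ℝ≥0∞, x * ENNReal.ofReal (Real.log x.toReal)
      ≤ ENNReal.ofReal (x.toReal * |Real.log x.toReal|) := by
    intro x
    by_cases hx : x = ∞
    · simp [hx]
    · rw [ENNReal.ofReal_mul ENNReal.toReal_nonneg, ENNReal.ofReal_toReal hx]
      gcongr
      exact le_abs_self _
  have hpt' : ∀ x : ℝ≥0∞, ENNReal.ofReal (x.toReal * |Real.log x.toReal|)
      ≤ x * ENNReal.ofReal (Real.log x.toReal) + 1 := by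
    intro x
    by_cases hx : x = ∞
    · simp [hx]
    · rcases le_total 1 x.toReal with h1 | h1
      · rw [abs_of_nonneg (Real.log_nonneg h1), ENNReal.ofReal_mul ENNReal.toReal_nonneg,
          ENNReal.ofReal_toReal hx]
        exact le_self_add
      · refine le_trans ?_ le_add_self
        rw [ENNReal.ofReal_le_one]
        rcases ENNReal.toReal_nonneg.eq_or_lt with h0 | h0
        · rw [← h0]; simp
        · have := Real.abs_log_mul_self_lt x.toReal h0 h1
          rw [abs_mul, abs_of_pos h0, mul_comm] at this
          exact this.le
  rw [lintegral_tiltLaw_family ν η θ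
    (F := fun p => ENNReal.ofReal (Real.log (familyMass η θ p.1 p.2).toReal))
    (measurable_familyMass η θ).ennreal_toReal.log.ennreal_ofReal]
  constructor
  · intro h
    refine lt_of_le_of_lt (lintegral_mono fun e => lintegral_mono fun c => hpt' _) ?_
    simp_rw [lintegral_add_right _ measurable_const]
    simp only [lintegral_const, measure_univ, mul_one]
    rw [lintegral_add_right _ measurable_const, lintegral_const, measure_univ, mul_one]
    exact ENNReal.add_lt_top.2 ⟨h, ENNReal.one_lt_top⟩
  · intro h
    exact lt_of_le_of_lt (lintegral_mono fun e => lintegral_mono fun c => hpt _) h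

end Moments

/-! ### Truncated weights on the family tree -/

/-- The potential individuals of the `n`-th generation. -/
abbrev Level (n : ℕ) : Type := {u : List ℕ // u.length = n}

/-- An individual of generation `n + 1` is given by its rank among its siblings and its parent. -/
noncomputable def levelSuccEquiv (n : ℕ) : Level n × ℕ ≃ Level (n + 1) :=
  Equiv.ofBijective (fun p => ⟨p.2 :: p.1.1, by simp [p.1.2]⟩) (by
    constructor
    · rintro ⟨⟨u, hu⟩, i⟩ ⟨⟨v, hv⟩, j⟩ h
      simp only [Subtype.mk.injEq, List.cons.injEq] at h
      obtain ⟨rfl, rfl⟩ := h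
      rfl
    · rintro ⟨u, hu⟩
      obtain _ | ⟨i, u⟩ := u
      · simp at hu
      · exact ⟨⟨⟨u, by simpa using hu⟩, i⟩, rfl⟩)

theorem tsum_level_zero (F : List ℕ → ℝ≥0∞) : ∑' u : Level 0, F u = F [] := by
  have : Unique (Level 0) :=
    ⟨⟨⟨[], rfl⟩⟩, fun u => Subtype.ext (List.eq_nil_of_length_eq_zero u.2)⟩
  rw [tsum_fintype, Fintype.sum_unique]
  exact congrArg F (List.eq_nil_of_length_eq_zero (default : Level 0).2)

theorem tsum_level_succ (n : ℕ) (F : List ℕ → ℝ≥0∞) :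
    ∑' u : Level (n + 1), F u = ∑' u : Level n, ∑' i : ℕ, F (i :: u) := by
  rw [← (levelSuccEquiv n).tsum_eq, ENNReal.tsum_prod']
  rfl

section Tree

set_option linter.unusedSectionVars false

variable {Θ : Type*} [MeasurableSpace Θ] (η : Kernel Θ PointConfig) (θ : ℝ) (b : ℕ → ℝ≥0∞)
  (ω : ℕ → Θ) (x : Family)

open Classical in
/-- The normalized exponential weight of an individual, set to zero as soon as, for an ancestor
of a generation `k`, the weight of the ancestor times the normalized mass of its family exceeds
`b k`. The choice `b = ⊤` gives the weights without truncation. -/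
noncomputable def truncWeight : List ℕ → ℝ≥0∞
  | [] => 1
  | i :: u =>
    if truncWeight u * familyMass η θ (ω u.length) (x u) ≤ b u.length then
      truncWeight u * (childWeight θ (x u) i / laplaceMean η (ω u.length) θ) else 0

/-- The sum of the truncated weights over the `n`-th generation. -/
noncomputable def truncSum (n : ℕ) : ℝ≥0∞ := ∑' u : Level n, truncWeight η θ b ω x u

variable {ω x} in
/-- The truncated weight of an individual depends only on the earlier generations. -/
theorem truncWeight_congr {ω' : ℕ → Θ} {x' : Family} {u : List ℕ}
    (hω : ∀ k < u.length, ω k = ω' k) (hx : ∀ v : List ℕ, v.length < u.length → x v = x' v) :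
    truncWeight η θ b ω x u = truncWeight η θ b ω' x' u := by
  induction u with
  | nil => rfl
  | cons i u ih =>
    have h1 := hω u.length (by simp)
    have h2 := hx u (by simp)
    have h3 := ih (fun k hk => hω k (hk.trans (by simp)))
      (fun v hv => hx v (hv.trans (by simp)))
    simp only [truncWeight, h1, h2, h3]

theorem truncWeight_update {u v : List ℕ} (h : v.length ≤ u.length) (c : PointConfig) :
    truncWeight η θ b ω (Function.update x u c) v = truncWeight η θ b ω x v :=
  truncWeight_congr η θ b (fun _ _ => rfl) fun w hw =>
    Function.update_of_ne (by rintro rfl; omega) _ _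

theorem truncWeight_update_env {n : ℕ} {v : List ℕ} (h : v.length ≤ n) (e : Θ) :
    truncWeight η θ b (Function.update ω n e) x v = truncWeight η θ b ω x v :=
  truncWeight_congr η θ b (fun _ hk => Function.update_of_ne (by omega) _ _) fun _ _ => rfl

variable [IsMarkovKernel η]

theorem measurable_truncWeight (u : List ℕ) :
    Measurable fun p : (ℕ → Θ) × Family => truncWeight η θ b p.1 p.2 u := by
  induction u with
  | nil => exact measurable_const
  | cons i u ih =>
    have hω : Measurable fun p : (ℕ → Θ) × Family => p.1 u.length := by fun_prop
    have hx : Measurable fun p : (ℕ → Θ) × Family => p.2 u :=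
      (measurable_pi_apply u).comp measurable_snd
    have h1 : Measurable fun p : (ℕ → Θ) × Family =>
        truncWeight η θ b p.1 p.2 u * familyMass η θ (p.1 u.length) (p.2 u) :=
      ih.mul ((measurable_familyMass η θ).comp (hω.prodMk hx))
    have h2 : Measurable fun p : (ℕ → Θ) × Family =>
        truncWeight η θ b p.1 p.2 u
          * (childWeight θ (p.2 u) i / laplaceMean η (p.1 u.length) θ) :=
      ih.mul (((measurable_childWeight θ i).comp hx).div ((measurable_laplaceMean η θ).comp hω))
    exact Measurable.ite (measurableSet_le h1 measurable_const) h2 measurable_const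

theorem measurable_truncSum (n : ℕ) :
    Measurable fun p : (ℕ → Θ) × Family => truncSum η θ b p.1 p.2 n :=
  Measurable.tsum fun u => measurable_truncWeight η θ b u

theorem measurable_truncWeight_right (u : List ℕ) :
    Measurable fun x : Family => truncWeight η θ b ω x u :=
  (measurable_truncWeight η θ b u).comp measurable_prodMk_left

theorem measurable_truncSum_right (n : ℕ) :
    Measurable fun x : Family => truncSum η θ b ω x n :=
  (measurable_truncSum η θ b n).comp measurable_prodMk_left

open Classical in
theorem truncSum_succ (n : ℕ) :
    truncSum η θ b ω x (n + 1) = ∑' u : Level n,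
      (if truncWeight η θ b ω x u * familyMass η θ (ω n) (x u) ≤ b n then
        truncWeight η θ b ω x u * familyMass η θ (ω n) (x u) else 0) := by
  rw [truncSum, tsum_level_succ]
  refine tsum_congr fun ⟨u, hu⟩ => ?_
  subst hu
  simp only [truncWeight]
  split_ifs with h
  · rw [ENNReal.tsum_mul_left, familyMass, atomSum_eq_tsum]
    simp_rw [div_eq_mul_inv, ENNReal.tsum_mul_right]
  · simp

theorem truncSum_top_succ (n : ℕ) :
    truncSum η θ ⊤ ω x (n + 1)
      = ∑' u : Level n, truncWeight η θ ⊤ ω x u * familyMass η θ (ω n) (x u) := by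
  simp [truncSum_succ]

theorem truncSum_zero : truncSum η θ b ω x 0 = 1 := by
  rw [truncSum, tsum_level_zero]; rfl

theorem truncWeight_le_top (u : List ℕ) :
    truncWeight η θ b ω x u ≤ truncWeight η θ ⊤ ω x u := by
  induction u with
  | nil => exact le_rfl
  | cons i u ih =>
    simp only [truncWeight, Pi.top_apply, le_top, if_true]
    split_ifs
    · exact mul_le_mul_left ih _
    · exact zero_le

theorem truncSum_le_top (n : ℕ) : truncSum η θ b ω x n ≤ truncSum η θ ⊤ ω x n :=
  ENNReal.tsum_le_tsum fun u => truncWeight_le_top η θ b ω x u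

variable {η θ b ω x} in
/-- As long as the sums over the generations stay below the barrier, nothing is truncated. -/
theorem truncSum_eq_top {n : ℕ} (h : ∀ k < n, truncSum η θ ⊤ ω x (k + 1) ≤ b k) :
    truncSum η θ b ω x n = truncSum η θ ⊤ ω x n := by
  have key : ∀ u : List ℕ, u.length ≤ n →
      truncWeight η θ b ω x u = truncWeight η θ ⊤ ω x u := by
    intro u
    induction u with
    | nil => intro _; rfl
    | cons i u ih =>
      intro hu
      rw [List.length_cons] at hu
      have h1 := ih (by omega)
      simp only [truncWeight, Pi.top_apply, le_top, if_true, h1]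
      rw [if_pos]
      refine le_trans ?_ (h u.length (by omega))
      rw [truncSum_top_succ]
      exact ENNReal.le_tsum (f := fun v : Level u.length =>
        truncWeight η θ ⊤ ω x v * familyMass η θ (ω u.length) (x v)) ⟨u, rfl⟩
  exact tsum_congr fun u => key u u.2.le

/-! ### The additive martingale as a sum of weights -/

theorem expSum_eq (n : ℕ) (hω : ∀ k, laplaceMean η (ω k) θ ≠ 0 ∧ laplaceMean η (ω k) θ ≠ ∞) :
    expSum θ n x = truncSum η θ ⊤ ω x n * ∏ k ∈ Finset.range n, laplaceMean η (ω k) θ := by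
  classical
  have key : ∀ u : List ℕ,
      (if Alive x u then ENNReal.ofReal (Real.exp (-θ * position x u)) else 0)
      = truncWeight η θ ⊤ ω x u * ∏ k ∈ Finset.range u.length, laplaceMean η (ω k) θ := by
    intro u
    induction u with
    | nil => simp [Alive, position, truncWeight]
    | cons i u ih =>
      have h1 : (if Alive x (i :: u) then
            ENNReal.ofReal (Real.exp (-θ * position x (i :: u))) else 0)
          = (if Alive x u then ENNReal.ofReal (Real.exp (-θ * position x u)) else 0)
            * childWeight θ (x u) i := by
        by_cases ha : Alive x u <;> by_cases hi : (i : ℕ∞) < (x u).1 <;>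
          simp [Alive, position, childWeight, ha, hi, mul_add, Real.exp_add,
            ENNReal.ofReal_mul (Real.exp_pos _).le]
      rw [h1, ih, List.length_cons, Finset.prod_range_succ]
      simp only [truncWeight, Pi.top_apply, le_top, if_true]
      set m := laplaceMean η (ω u.length) θ
      have : childWeight θ (x u) i = childWeight θ (x u) i / m * m :=
        (ENNReal.div_mul_cancel (hω u.length).1 (hω u.length).2).symm
      conv_lhs => rw [this]
      ring
  rw [expSum, truncSum, ← ENNReal.tsum_mul_right]
  have h2 : ∀ u : List ℕ, (if u.length = n ∧ Alive x u then
        ENNReal.ofReal (Real.exp (-θ * position x u)) else 0)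
      = Set.indicator {u : List ℕ | u.length = n} (fun u =>
        if Alive x u then ENNReal.ofReal (Real.exp (-θ * position x u)) else 0) u := by
    intro u
    by_cases h : u.length = n <;> simp [h]
  rw [tsum_congr h2, ← tsum_subtype]
  refine tsum_congr fun u => ?_
  rw [key u, u.2]

/-! ### One-step moments under the quenched law -/

/-- The mass of the family of an individual has mean one and is independent of everything that
does not look at this family. -/
theorem lintegral_mul_familyMass (u : List ℕ)
    (hω : ∀ k, laplaceMean η (ω k) θ ≠ 0 ∧ laplaceMean η (ω k) θ ≠ ∞)
    {G : Family → ℝ≥0∞} (hG : Measurable G)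
    (hGu : ∀ x c, G (Function.update x u c) = G x) :
    ∫⁻ x, G x * familyMass η θ (ω u.length) (x u) ∂(quenchedMeasure η ω)
      = ∫⁻ x, G x ∂(quenchedMeasure η ω) := by
  have hm : Measurable fun x : Family => familyMass η θ (ω u.length) (x u) :=
    (measurable_familyMass_right η θ _).comp (measurable_pi_apply u)
  rw [quenchedMeasure, lintegral_infinitePi_update _ u (hG.fun_mul hm)]
  refine lintegral_congr fun x => ?_
  simp only [hGu, Function.update_self]
  rw [lintegral_const_mul _ (measurable_familyMass_right η θ _),
    lintegral_familyMass η θ (hω _).1 (hω _).2, mul_one]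

/-- The martingale property, tested against a function of the first generations. -/
theorem lintegral_mul_truncSum_top_succ (n : ℕ)
    (hω : ∀ k, laplaceMean η (ω k) θ ≠ 0 ∧ laplaceMean η (ω k) θ ≠ ∞)
    {g : Family → ℝ≥0∞} (hg : Measurable g)
    (hgu : ∀ x u c, n ≤ u.length → g (Function.update x u c) = g x) :
    ∫⁻ x, g x * truncSum η θ ⊤ ω x (n + 1) ∂(quenchedMeasure η ω)
      = ∫⁻ x, g x * truncSum η θ ⊤ ω x n ∂(quenchedMeasure η ω) := by
  have hm : ∀ u : List ℕ, Measurable fun x : Family => familyMass η θ (ω n) (x u) := fun u =>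
    (measurable_familyMass_right η θ _).comp (measurable_pi_apply u)
  simp_rw [truncSum_top_succ, truncSum, ← ENNReal.tsum_mul_left, ← mul_assoc]
  rw [lintegral_tsum fun u : Level n =>
      ((hg.fun_mul (measurable_truncWeight_right η θ ⊤ ω u)).fun_mul (hm u)).aemeasurable,
    lintegral_tsum fun u : Level n =>
      (hg.fun_mul (measurable_truncWeight_right η θ ⊤ ω u)).aemeasurable]
  refine tsum_congr fun ⟨u, hu⟩ => ?_
  subst hu
  refine lintegral_mul_familyMass η θ ω u hω
    (hg.fun_mul (measurable_truncWeight_right η θ ⊤ ω u)) ?_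
  intro x c
  rw [hgu x u c le_rfl, truncWeight_update η θ ⊤ ω x le_rfl c]

theorem lintegral_truncSum_top (n : ℕ)
    (hω : ∀ k, laplaceMean η (ω k) θ ≠ 0 ∧ laplaceMean η (ω k) θ ≠ ∞) :
    ∫⁻ x, truncSum η θ ⊤ ω x n ∂(quenchedMeasure η ω) = 1 := by
  induction n with
  | zero => simp [truncSum_zero]
  | succ n ih =>
    have := lintegral_mul_truncSum_top_succ η θ ω n hω (g := fun _ => 1) measurable_const
      (fun _ _ _ _ => rfl)
    simpa [ih] using this

theorem W_eq_truncSum (n : ℕ) {p : (ℕ → Θ) × Family}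
    (hω : ∀ k, laplaceMean η (p.1 k) θ ≠ 0 ∧ laplaceMean η (p.1 k) θ ≠ ∞) :
    W η θ n p = truncSum η θ ⊤ p.1 p.2 n := by
  have hM0 : ∏ k ∈ Finset.range n, laplaceMean η (p.1 k) θ ≠ 0 :=
    Finset.prod_ne_zero_iff.2 fun k _ => (hω k).1
  have hM1 : ∏ k ∈ Finset.range n, laplaceMean η (p.1 k) θ ≠ ∞ :=
    ENNReal.prod_ne_top fun k _ => (hω k).2
  have hint : ∫⁻ x, expSum θ n x ∂(quenchedLaw η p.1)
      = ∏ k ∈ Finset.range n, laplaceMean η (p.1 k) θ := by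
    simp_rw [expSum_eq η θ p.1 _ n hω]
    rw [lintegral_mul_const _ (measurable_truncSum_right η θ ⊤ p.1 n)]
    exact (congrArg (· * _) (lintegral_truncSum_top η θ p.1 n hω)).trans (one_mul _)
  rw [W, hint, expSum_eq η θ p.1 _ n hω, ENNReal.mul_div_cancel_right hM0 hM1]

/-- The second moment grows by at most the barrier in each generation. -/
theorem lintegral_truncSum_sq_succ_le (n : ℕ)
    (hω : ∀ k, laplaceMean η (ω k) θ ≠ 0 ∧ laplaceMean η (ω k) θ ≠ ∞) :
    ∫⁻ x, truncSum η θ b ω x (n + 1) ^ 2 ∂(quenchedMeasure η ω)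
      ≤ ∫⁻ x, truncSum η θ b ω x n ^ 2 ∂(quenchedMeasure η ω)
        + b n * ∫⁻ x, truncSum η θ b ω x n ∂(quenchedMeasure η ω) := by
  classical
  have ht := measurable_truncWeight_right η θ b ω
  have hm : ∀ u : List ℕ, Measurable fun x : Family => familyMass η θ (ω n) (x u) := fun u =>
    (measurable_familyMass_right η θ _).comp (measurable_pi_apply u)
  set Z : Family → Level n → ℝ≥0∞ := fun x u =>
    if truncWeight η θ b ω x u * familyMass η θ (ω n) (x u) ≤ b n then
      truncWeight η θ b ω x u * familyMass η θ (ω n) (x u) else 0 with hZ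
  have hZm : ∀ u, Measurable fun x => Z x u := fun u =>
    Measurable.ite (measurableSet_le ((ht u).mul (hm u)) measurable_const)
      ((ht u).mul (hm u)) measurable_const
  have hZle : ∀ x u, Z x u ≤ truncWeight η θ b ω x u * familyMass η θ (ω n) (x u) := by
    intro x u
    simp only [hZ]; split_ifs
    · exact le_rfl
    · exact zero_le
  have hZb : ∀ x u, Z x u ≤ b n := by
    intro x u
    simp only [hZ]; split_ifs with h
    · exact h
    · exact zero_le
  -- different individuals reproduce independently; on the diagonal one factor is below the barrier
  have hpair : ∀ u v : Level n, ∫⁻ x, Z x u * Z x v ∂(quenchedMeasure η ω)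
      ≤ ∫⁻ x, truncWeight η θ b ω x u * truncWeight η θ b ω x v ∂(quenchedMeasure η ω)
        + (if v = u then b n * ∫⁻ x, truncWeight η θ b ω x u ∂(quenchedMeasure η ω) else 0) := by
    intro u v
    by_cases huv : v = u
    · subst huv
      rw [if_pos rfl]
      refine le_trans ?_ le_add_self
      calc ∫⁻ x, Z x v * Z x v ∂(quenchedMeasure η ω)
          ≤ ∫⁻ x, b n * (truncWeight η θ b ω x v * familyMass η θ (ω n) (x v))
              ∂(quenchedMeasure η ω) :=
            lintegral_mono fun x => mul_le_mul' (hZb x v) (hZle x v)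
        _ = b n * ∫⁻ x, truncWeight η θ b ω x v * familyMass η θ (ω n) (x v)
              ∂(quenchedMeasure η ω) := lintegral_const_mul _ ((ht v).mul (hm v))
        _ = _ := by
            obtain ⟨v, rfl⟩ := v
            rw [lintegral_mul_familyMass η θ ω v hω (ht v)
              fun x c => truncWeight_update η θ b ω x le_rfl c]
    · rw [if_neg huv, add_zero]
      obtain ⟨u, rfl⟩ := u
      obtain ⟨v, hv⟩ := v
      have hne : v ≠ u := fun h => huv (Subtype.ext h)
      calc ∫⁻ x, Z x ⟨u, rfl⟩ * Z x ⟨v, hv⟩ ∂(quenchedMeasure η ω)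
          ≤ ∫⁻ x, (truncWeight η θ b ω x u * truncWeight η θ b ω x v
              * familyMass η θ (ω v.length) (x v)) * familyMass η θ (ω u.length) (x u)
              ∂(quenchedMeasure η ω) := by
            refine lintegral_mono fun x => (mul_le_mul' (hZle x _) (hZle x _)).trans (le_of_eq ?_)
            rw [hv]; ring
        _ = ∫⁻ x, truncWeight η θ b ω x u * truncWeight η θ b ω x v
              * familyMass η θ (ω v.length) (x v) ∂(quenchedMeasure η ω) := by
            refine lintegral_mul_familyMass η θ ω u hω
              (((ht u).mul (ht v)).mul (hv ▸ hm v)) fun x c => ?_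
            rw [truncWeight_update η θ b ω x le_rfl c, truncWeight_update η θ b ω x hv.le c,
              Function.update_of_ne hne]
        _ = ∫⁻ x, truncWeight η θ b ω x u * truncWeight η θ b ω x v ∂(quenchedMeasure η ω) := by
            refine lintegral_mul_familyMass η θ ω v hω ((ht u).fun_mul (ht v)) fun x c => ?_
            rw [truncWeight_update η θ b ω x le_rfl c, truncWeight_update η θ b ω x hv.ge c]
  have hsq : ∀ {F : Family → Level n → ℝ≥0∞}, (∀ u, Measurable fun x => F x u) →
      ∫⁻ x, (∑' u, F x u) ^ 2 ∂(quenchedMeasure η ω)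
        = ∑' u, ∑' v, ∫⁻ x, F x u * F x v ∂(quenchedMeasure η ω) := by
    intro F hF
    simp_rw [sq, ← ENNReal.tsum_mul_right, ← ENNReal.tsum_mul_left]
    rw [lintegral_tsum fun u => (Measurable.tsum fun v => (hF u).fun_mul (hF v)).aemeasurable]
    refine tsum_congr fun u => ?_
    exact lintegral_tsum fun v => ((hF u).fun_mul (hF v)).aemeasurable
  have e1 : ∫⁻ x, truncSum η θ b ω x (n + 1) ^ 2 ∂(quenchedMeasure η ω)
      = ∑' u, ∑' v, ∫⁻ x, Z x u * Z x v ∂(quenchedMeasure η ω) := by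
    rw [← hsq hZm]
    simp_rw [truncSum_succ]
    rfl
  have e2 : ∫⁻ x, truncSum η θ b ω x n ^ 2 ∂(quenchedMeasure η ω)
      = ∑' u : Level n, ∑' v : Level n,
        ∫⁻ x, truncWeight η θ b ω x u * truncWeight η θ b ω x v ∂(quenchedMeasure η ω) :=
    hsq fun u => ht u
  have e3 : ∫⁻ x, truncSum η θ b ω x n ∂(quenchedMeasure η ω)
      = ∑' u : Level n, ∫⁻ x, truncWeight η θ b ω x u ∂(quenchedMeasure η ω) :=
    lintegral_tsum fun u => (ht u).aemeasurable
  rw [e1, e2, e3]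
  refine (ENNReal.tsum_le_tsum fun u => ENNReal.tsum_le_tsum fun v => hpair u v).trans ?_
  simp_rw [ENNReal.tsum_add, tsum_ite_eq, ENNReal.tsum_mul_left]
  exact le_rfl

theorem lintegral_truncSum_sq_le (n : ℕ)
    (hω : ∀ k, laplaceMean η (ω k) θ ≠ 0 ∧ laplaceMean η (ω k) θ ≠ ∞) :
    ∫⁻ x, truncSum η θ b ω x n ^ 2 ∂(quenchedMeasure η ω) ≤ 1 + ∑ k ∈ Finset.range n, b k := by
  induction n with
  | zero => simp [truncSum_zero]
  | succ n ih =>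
    refine (lintegral_truncSum_sq_succ_le η θ b ω n hω).trans ?_
    rw [Finset.sum_range_succ, ← add_assoc]
    refine add_le_add ih ?_
    refine (mul_le_mul_right ?_ _).trans (mul_one _).le
    exact (lintegral_mono fun x => truncSum_le_top η θ b ω x n).trans
      (lintegral_truncSum_top η θ ω n hω).le

end Tree

/-! ### The many-to-one formula -/

section ManyToOne

set_option linter.unusedSectionVars false

variable {Θ : Type*} [MeasurableSpace Θ] (ν : Measure Θ) [IsProbabilityMeasure ν]
  (η : Kernel Θ PointConfig) [IsMarkovKernel η] (θ : ℝ) (b : ℕ → ℝ≥0∞)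

theorem lintegral_annealedLaw {F : (ℕ → Θ) × Family → ℝ≥0∞} (hF : Measurable F) :
    ∫⁻ p, F p ∂(annealedLaw ν η)
      = ∫⁻ ω, ∫⁻ x, F (ω, x) ∂(quenchedMeasure η ω) ∂(envLaw ν) :=
  Measure.lintegral_compProd hF

/-- The quenched expectation of a functional that does not look at generation `n` does not depend
on the environment state of generation `n`. -/
theorem lintegral_quenchedMeasure_congr (n : ℕ) {ω ω' : ℕ → Θ} (hω : ∀ k, k ≠ n → ω k = ω' k)
    {G : Family → ℝ≥0∞} (hG : Measurable G)
    (hGn : ∀ x x' : Family, (∀ u : List ℕ, u.length ≠ n → x u = x' u) → G x = G x') :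
    ∫⁻ x, G x ∂(quenchedMeasure η ω) = ∫⁻ x, G x ∂(quenchedMeasure η ω') := by
  classical
  -- erasing generation `n` turns both laws into the same product measure
  set f : List ℕ → PointConfig → PointConfig := fun u c => if u.length = n then default else c
    with hf
  have hfm : ∀ u, Measurable (f u) := by
    intro u
    by_cases h : u.length = n
    · simp [hf, h]
    · simp only [hf, h, if_false]; fun_prop
  have hmap : (quenchedMeasure η ω).map (fun x u => f u (x u))
      = (quenchedMeasure η ω').map (fun x u => f u (x u)) := by
    rw [quenchedMeasure, quenchedMeasure, Measure.infinitePi_map_pi _ hfm,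
      Measure.infinitePi_map_pi _ hfm]
    congr 1
    funext u
    by_cases h : u.length = n
    · have : f u = fun _ => default := by simp [hf, h]
      rw [this, Measure.map_const, Measure.map_const, measure_univ, measure_univ]
    · rw [hω _ h]
  have hr : Measurable fun (x : Family) (u : List ℕ) => f u (x u) :=
    measurable_pi_lambda _ fun u => (hfm u).comp (measurable_pi_apply u)
  have hGr : ∀ x, G x = G fun u => f u (x u) := fun x =>
    hGn _ _ fun u hu => by simp [hf, hu]
  calc ∫⁻ x, G x ∂(quenchedMeasure η ω)
      = ∫⁻ x, G (fun u => f u (x u)) ∂(quenchedMeasure η ω) := lintegral_congr hGr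
    _ = ∫⁻ x, G x ∂((quenchedMeasure η ω).map fun x u => f u (x u)) :=
        (lintegral_map hG hr).symm
    _ = ∫⁻ x, G (fun u => f u (x u)) ∂(quenchedMeasure η ω') := by
        rw [hmap, lintegral_map hG hr]
    _ = ∫⁻ x, G x ∂(quenchedMeasure η ω') := (lintegral_congr hGr).symm

/-- Under the annealed law, the environment and the family of an individual of generation `n`
are independent of its truncated weight. -/
theorem lintegral_annealed_resample {n : ℕ} {u : List ℕ} (hu : u.length = n)
    {φ : ℝ≥0∞ × Θ × PointConfig → ℝ≥0∞} (hφ : Measurable φ) :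
    ∫⁻ ω, ∫⁻ x, φ (truncWeight η θ b ω x u, ω n, x u) ∂(quenchedMeasure η ω) ∂(envLaw ν)
      = ∫⁻ ω, ∫⁻ x, ∫⁻ e, ∫⁻ c, φ (truncWeight η θ b ω x u, e, c) ∂(η e) ∂ν
          ∂(quenchedMeasure η ω) ∂(envLaw ν) := by
  have ht := measurable_truncWeight η θ b u
  -- resampling the family of `u`
  have h1 : ∀ ω, ∫⁻ x, φ (truncWeight η θ b ω x u, ω n, x u) ∂(quenchedMeasure η ω)
      = ∫⁻ x, ∫⁻ c, φ (truncWeight η θ b ω x u, ω n, c) ∂(η (ω n)) ∂(quenchedMeasure η ω) := by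
    intro ω
    have hm : Measurable fun x : Family => φ (truncWeight η θ b ω x u, ω n, x u) :=
      hφ.comp ((measurable_truncWeight_right η θ b ω u).prodMk
        (measurable_const.prodMk (measurable_pi_apply u)))
    rw [quenchedMeasure, lintegral_infinitePi_update _ u hm]
    simp only [truncWeight_update η θ b ω _ le_rfl, Function.update_self, hu]
  -- resampling the environment state of generation `n`
  have hK : Measurable fun q : (ℝ≥0∞ × Θ) => ∫⁻ c, φ (q.1, q.2, c) ∂(η q.2) := by
    refine Measurable.lintegral_kernel_prod_right (κ := η.comap Prod.snd measurable_snd)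
      (f := fun (q : ℝ≥0∞ × Θ) c => φ (q.1, q.2, c)) ?_
    exact hφ.comp (by fun_prop)
  have hK2 : Measurable fun ω : ℕ → Θ =>
      ∫⁻ x, ∫⁻ c, φ (truncWeight η θ b ω x u, ω n, c) ∂(η (ω n)) ∂(quenchedMeasure η ω) := by
    refine Measurable.lintegral_kernel_prod_right (κ := quenchedLaw η)
      (f := fun (ω : ℕ → Θ) x => ∫⁻ c, φ (truncWeight η θ b ω x u, ω n, c) ∂(η (ω n))) ?_
    exact hK.comp (ht.prodMk ((measurable_pi_apply n).comp measurable_fst))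
  simp_rw [h1]
  rw [envLaw, lintegral_infinitePi_update _ n hK2]
  refine lintegral_congr fun ω => ?_
  simp only [Function.update_self]
  have h2 : ∀ e, ∫⁻ x, ∫⁻ c, φ (truncWeight η θ b (Function.update ω n e) x u, e, c) ∂(η e)
        ∂(quenchedMeasure η (Function.update ω n e))
      = ∫⁻ x, ∫⁻ c, φ (truncWeight η θ b ω x u, e, c) ∂(η e) ∂(quenchedMeasure η ω) := by
    intro e
    simp only [truncWeight_update_env η θ b ω _ hu.le]
    refine lintegral_quenchedMeasure_congr η n (fun k hk => Function.update_of_ne hk _ _) ?_ ?_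
    · exact hK.comp ((measurable_truncWeight_right η θ b ω u).prodMk measurable_const)
    · intro x x' hx
      simp only [truncWeight_congr η θ b (ω := ω) (ω' := ω) (u := u) (fun _ _ => rfl)
        fun v hv => hx v (by omega)]
  simp_rw [h2]
  refine lintegral_lintegral_swap (Measurable.aemeasurable ?_)
  exact hK.comp (((measurable_truncWeight_right η θ b ω u).comp measurable_snd).prodMk
    measurable_fst)

/-- The event that the tilted walk, perturbed by the masses of the families, respects the
barrier up to time `n`. -/
def belowBarrier (n : ℕ) : Set (ℕ → Θ × PointConfig × ℕ) :=
  {y | ∀ k < n, (∏ j ∈ Finset.range k, tiltDensity η θ (y j))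
    * familyMass η θ (y k).1 (y k).2.1 ≤ b k}

theorem measurable_prod_tiltDensity (n : ℕ) :
    Measurable fun y : ℕ → Θ × PointConfig × ℕ =>
      ∏ j ∈ Finset.range n, tiltDensity η θ (y j) :=
  Finset.measurable_prod _ fun j _ => (measurable_tiltDensity η θ).comp (measurable_pi_apply j)

theorem measurable_familyMass_coord :
    Measurable fun s : Θ × PointConfig × ℕ => familyMass η θ s.1 s.2.1 :=
  (measurable_familyMass η θ).comp
    (measurable_fst.prodMk (measurable_fst.comp measurable_snd))

theorem measurableSet_belowBarrier (n : ℕ) : MeasurableSet (belowBarrier η θ b n) := by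
  simp only [belowBarrier, Set.ofPred_forall]
  refine MeasurableSet.iInter fun k => MeasurableSet.iInter fun _ => ?_
  exact measurableSet_le ((measurable_prod_tiltDensity η θ k).mul
    ((measurable_familyMass_coord η θ).comp (measurable_pi_apply k))) measurable_const

/-- The many-to-one formula for truncated weights: the sum over the individuals of a generation,
weighted by their truncated weights, is an expectation for the tilted walk below the barrier. -/
theorem lintegral_tsum_truncWeight [IsProbabilityMeasure (tiltLaw ν η θ)] (n : ℕ)
    {f : ℝ≥0∞ → ℝ≥0∞} (hf : Measurable f) :
    ∫⁻ ω, ∫⁻ x, ∑' u : Level n, truncWeight η θ b ω x u * f (truncWeight η θ b ω x u)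
        ∂(quenchedMeasure η ω) ∂(envLaw ν)
      = ∫⁻ y, (belowBarrier η θ b n).indicator
          (fun y => f (∏ j ∈ Finset.range n, tiltDensity η θ (y j))) y
          ∂(Measure.infinitePi fun _ : ℕ => tiltLaw ν η θ) := by
  classical
  induction n generalizing f with
  | zero =>
    have h1 : ∀ ω x, ∑' u : Level 0, truncWeight η θ b ω x u * f (truncWeight η θ b ω x u)
        = f 1 := by
      intro ω x
      rw [tsum_level_zero fun u => truncWeight η θ b ω x u * f (truncWeight η θ b ω x u)]
      simp [truncWeight]
    simp [h1, belowBarrier]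
  | succ n ih =>
    have hcw : ∀ i : ℕ, Measurable fun q : ℝ≥0∞ × Θ × PointConfig =>
        childWeight θ q.2.2 i / laplaceMean η q.2.1 θ := fun i =>
      ((measurable_childWeight θ i).comp (by fun_prop)).div
        ((measurable_laplaceMean η θ).comp (by fun_prop))
    -- the contribution of the children of an individual of weight `w`, given its environment state
    -- and its family, and the mean `h w` of this contribution
    set H : ℝ≥0∞ × Θ × PointConfig → ℝ≥0∞ := fun q =>
      if q.1 * familyMass η θ q.2.1 q.2.2 ≤ b n then
        ∑' i : ℕ, childWeight θ q.2.2 i / laplaceMean η q.2.1 θ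
          * f (q.1 * (childWeight θ q.2.2 i / laplaceMean η q.2.1 θ)) else 0 with hHdef
    have hH : Measurable H := by
      refine Measurable.ite (measurableSet_le (measurable_fst.mul
        ((measurable_familyMass η θ).comp measurable_snd)) measurable_const) ?_ measurable_const
      exact Measurable.tsum fun i => (hcw i).mul (hf.comp (measurable_fst.mul (hcw i)))
    set h : ℝ≥0∞ → ℝ≥0∞ := fun w => ∫⁻ e, ∫⁻ c, H (w, e, c) ∂(η e) ∂ν with hhdef
    have hh : Measurable h := by
      have h1 : Measurable fun q : ℝ≥0∞ × Θ => ∫⁻ c, H (q.1, q.2, c) ∂(η q.2) :=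
        Measurable.lintegral_kernel_prod_right (κ := η.comap Prod.snd measurable_snd)
          (f := fun (q : ℝ≥0∞ × Θ) c => H (q.1, q.2, c)) (hH.comp (by fun_prop))
      exact h1.lintegral_prod_right'
    have ht : ∀ u : List ℕ, Measurable fun p : (ℕ → Θ) × Family => truncWeight η θ b p.1 p.2 u :=
      measurable_truncWeight η θ b
    have hlhs : ∀ ω x, ∑' u : Level (n + 1),
        truncWeight η θ b ω x u * f (truncWeight η θ b ω x u)
        = ∑' u : Level n, truncWeight η θ b ω x u * H (truncWeight η θ b ω x u, ω n, x u) := by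
      intro ω x
      rw [tsum_level_succ n fun u => truncWeight η θ b ω x u * f (truncWeight η θ b ω x u)]
      refine tsum_congr fun ⟨u, hu⟩ => ?_
      subst hu
      simp only [truncWeight, hHdef]
      split_ifs
      · rw [← ENNReal.tsum_mul_left]
        exact tsum_congr fun i => mul_assoc _ _ _
      · simp
    have hsum : ∀ {ψ : List ℕ → (ℕ → Θ) × Family → ℝ≥0∞}, (∀ u, Measurable (ψ u)) →
        ∫⁻ ω, ∫⁻ x, ∑' u : Level n, ψ u (ω, x) ∂(quenchedMeasure η ω) ∂(envLaw ν)
          = ∑' u : Level n, ∫⁻ ω, ∫⁻ x, ψ u (ω, x) ∂(quenchedMeasure η ω) ∂(envLaw ν) := by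
      intro ψ hψ
      have h1 : ∀ ω, ∫⁻ x, ∑' u : Level n, ψ u (ω, x) ∂(quenchedMeasure η ω)
          = ∑' u : Level n, ∫⁻ x, ψ u (ω, x) ∂(quenchedMeasure η ω) := fun ω =>
        lintegral_tsum fun u => ((hψ u).comp measurable_prodMk_left).aemeasurable
      simp_rw [h1]
      exact lintegral_tsum fun u => (Measurable.lintegral_kernel_prod_right
        (κ := quenchedLaw η) (f := fun ω x => ψ u (ω, x)) (hψ u)).aemeasurable
    have hstep : ∫⁻ ω, ∫⁻ x, ∑' u : Level n,
          truncWeight η θ b ω x u * H (truncWeight η θ b ω x u, ω n, x u)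
          ∂(quenchedMeasure η ω) ∂(envLaw ν)
        = ∫⁻ ω, ∫⁻ x, ∑' u : Level n, truncWeight η θ b ω x u * h (truncWeight η θ b ω x u)
          ∂(quenchedMeasure η ω) ∂(envLaw ν) := by
      rw [hsum (ψ := fun u p => truncWeight η θ b p.1 p.2 u
          * H (truncWeight η θ b p.1 p.2 u, p.1 n, p.2 u))
        fun u => (ht u).mul (hH.comp ((ht u).prodMk
          (((measurable_pi_apply n).comp measurable_fst).prodMk
            ((measurable_pi_apply u).comp measurable_snd)))),
        hsum (ψ := fun u p => truncWeight η θ b p.1 p.2 u * h (truncWeight η θ b p.1 p.2 u))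
        fun u => (ht u).mul (hh.comp (ht u))]
      refine tsum_congr fun u => ?_
      have := lintegral_annealed_resample ν η θ b u.2 (φ := fun q => q.1 * H q)
        (measurable_fst.mul hH)
      simp only at this
      rw [this]
      refine lintegral_congr fun ω => lintegral_congr fun x => ?_
      simp only [hhdef]
      rw [← lintegral_const_mul]
      · refine lintegral_congr fun e => lintegral_const_mul _ (hH.comp (by fun_prop))
      · exact Measurable.lintegral_kernel_prod_right (κ := η)
          (f := fun e c => H (truncWeight η θ b ω x u, e, c)) (hH.comp (by fun_prop))
    have hrhs : Measurable ((belowBarrier η θ b (n + 1)).indicator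
        fun y => f (∏ j ∈ Finset.range (n + 1), tiltDensity η θ (y j))) :=
      (hf.comp (measurable_prod_tiltDensity η θ (n + 1))).indicator
        (measurableSet_belowBarrier η θ b (n + 1))
    simp_rw [hlhs]
    rw [hstep, ih hh, lintegral_infinitePi_update (fun _ : ℕ => tiltLaw ν η θ) n hrhs]
    refine lintegral_congr fun y => ?_
    have hprod : ∀ k ≤ n, ∀ s, ∏ j ∈ Finset.range k, tiltDensity η θ (Function.update y n s j)
        = ∏ j ∈ Finset.range k, tiltDensity η θ (y j) := by
      intro k hk s
      refine Finset.prod_congr rfl fun j hj => ?_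
      rw [Function.update_of_ne]
      have := Finset.mem_range.1 hj
      omega
    have hmem : ∀ s, Function.update y n s ∈ belowBarrier η θ b (n + 1)
        ↔ y ∈ belowBarrier η θ b n ∧ (∏ j ∈ Finset.range n, tiltDensity η θ (y j))
          * familyMass η θ s.1 s.2.1 ≤ b n := by
      intro s
      simp only [belowBarrier, Set.mem_ofPred_eq, Nat.forall_lt_succ_right]
      refine and_congr (forall₂_congr fun k hk => ?_) ?_
      · rw [hprod k hk.le, Function.update_of_ne hk.ne]
      · rw [hprod n le_rfl, Function.update_self]
    by_cases hy : y ∈ belowBarrier η θ b n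
    · rw [Set.indicator_of_mem hy]
      set w := ∏ j ∈ Finset.range n, tiltDensity η θ (y j) with hw
      have hF : ∀ s, (belowBarrier η θ b (n + 1)).indicator
          (fun y => f (∏ j ∈ Finset.range (n + 1), tiltDensity η θ (y j)))
            (Function.update y n s)
          = if w * familyMass η θ s.1 s.2.1 ≤ b n then f (w * tiltDensity η θ s) else 0 := by
        intro s
        rw [Set.indicator_apply]
        simp only [hmem s, hy, true_and, Finset.prod_range_succ, hprod n le_rfl s,
          Function.update_self]
        rfl
      simp_rw [hF]
      rw [lintegral_tiltLaw ν η θ (F := fun s =>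
        if w * familyMass η θ s.1 s.2.1 ≤ b n then f (w * tiltDensity η θ s) else 0)
        (Measurable.ite (measurableSet_le ((measurable_familyMass_coord η θ).const_mul w)
          measurable_const) (hf.comp ((measurable_tiltDensity η θ).const_mul w))
          measurable_const)]
      refine lintegral_congr fun e => lintegral_congr fun c => ?_
      simp only [hHdef]
      split_ifs
      · refine tsum_congr fun i => ?_
        by_cases hi : (i : ℕ∞) < c.1 <;> simp [childWeight, tiltDensity, hi]
      · simp
    · rw [Set.indicator_of_notMem hy]
      have : ∀ s, (belowBarrier η θ b (n + 1)).indicator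
          (fun y => f (∏ j ∈ Finset.range (n + 1), tiltDensity η θ (y j)))
            (Function.update y n s) = 0 := fun s =>
        Set.indicator_of_notMem (fun h => hy ((hmem s).1 h).1) _
      simp [this]

theorem lintegral_truncSum [IsProbabilityMeasure (tiltLaw ν η θ)] (n : ℕ) :
    ∫⁻ p, truncSum η θ b p.1 p.2 n ∂(annealedLaw ν η)
      = (Measure.infinitePi fun _ : ℕ => tiltLaw ν η θ) (belowBarrier η θ b n) := by
  rw [lintegral_annealedLaw ν η (measurable_truncSum η θ b n)]
  have := lintegral_tsum_truncWeight ν η θ b n (f := fun _ => 1) measurable_const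
  simp only [mul_one] at this
  rw [← lintegral_indicator_one (measurableSet_belowBarrier η θ b n)]
  exact this

end ManyToOne

/-! ### Convergence of the additive martingale -/

/-- The information carried by the first `n` generations, encoded as the measurable sets that are
insensitive to the families of the individuals of the generations `n, n + 1, …`. -/
def generationFiltration : Filtration ℕ (inferInstance : MeasurableSpace Family) where
  seq n :=
    { MeasurableSet' := fun A => MeasurableSet A ∧
        ∀ (x : Family) (u : List ℕ) (c : PointConfig), n ≤ u.length →
          (Function.update x u c ∈ A ↔ x ∈ A)
      measurableSet_empty := ⟨MeasurableSet.empty, fun _ _ _ _ => Iff.rfl⟩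
      measurableSet_compl := fun A hA =>
        ⟨hA.1.compl, fun x u c hu => not_congr (hA.2 x u c hu)⟩
      measurableSet_iUnion := fun A hA =>
        ⟨MeasurableSet.iUnion fun i => (hA i).1, fun x u c hu => by
          simp only [Set.mem_iUnion]
          exact exists_congr fun i => (hA i).2 x u c hu⟩ }
  mono' _ _ hnm _ hA := ⟨hA.1, fun x u c hu => hA.2 x u c (hnm.trans hu)⟩
  le' _ _ hA := hA.1

theorem measurable_generationFiltration {β : Type*} [MeasurableSpace β] {n : ℕ} {f : Family → β}
    (hf : Measurable f)
    (hfu : ∀ x u c, n ≤ u.length → f (Function.update x u c) = f x) :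
    Measurable[generationFiltration n] f :=
  fun B hB => ⟨hf hB, fun x u c hu => by simp only [Set.mem_preimage, hfu x u c hu]⟩

section Convergence

set_option linter.unusedSectionVars false

variable {Θ : Type*} [MeasurableSpace Θ] {ν : Measure Θ} [IsProbabilityMeasure ν]
  {η : Kernel Θ PointConfig} [IsMarkovKernel η] {θ : ℝ}

instance (ν : Measure Θ) [IsProbabilityMeasure ν] (η : Kernel Θ PointConfig) [IsMarkovKernel η] :
    IsProbabilityMeasure (annealedLaw ν η) := by
  unfold annealedLaw; infer_instance

theorem truncSum_update (b : ℕ → ℝ≥0∞) (ω : ℕ → Θ) (x : Family) {n : ℕ} {u : List ℕ}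
    (hu : n ≤ u.length) (c : PointConfig) :
    truncSum η θ b ω (Function.update x u c) n = truncSum η θ b ω x n :=
  tsum_congr fun v => truncWeight_update η θ b ω x (v.2.le.trans hu) c

theorem martingale_truncSum {ω : ℕ → Θ}
    (hω : ∀ k, laplaceMean η (ω k) θ ≠ 0 ∧ laplaceMean η (ω k) θ ≠ ∞) :
    Martingale (fun n x => (truncSum η θ ⊤ ω x n).toReal) generationFiltration
      (quenchedMeasure η ω) := by
  have hm := measurable_truncSum_right η θ ⊤ ω
  have hne : ∀ n, ∫⁻ x, truncSum η θ ⊤ ω x n ∂(quenchedMeasure η ω) ≠ ∞ := fun n => by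
    rw [lintegral_truncSum_top η θ ω n hω]; exact ENNReal.one_ne_top
  refine martingale_of_setIntegral_eq_succ (fun n => ?_) (fun n => ?_) fun n A hA => ?_
  · refine Measurable.stronglyMeasurable ?_
    refine measurable_generationFiltration (hm n).ennreal_toReal fun x u c hu => ?_
    rw [truncSum_update ⊤ ω x hu c]
  · exact integrable_toReal_of_lintegral_ne_top (hm n).aemeasurable (hne n)
  · have hset : ∀ k, ∫ x in A, (truncSum η θ ⊤ ω x k).toReal ∂(quenchedMeasure η ω)
        = (∫⁻ x, A.indicator 1 x * truncSum η θ ⊤ ω x k ∂(quenchedMeasure η ω)).toReal := by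
      intro k
      rw [integral_toReal (hm k).aemeasurable
        (ae_restrict_of_ae (ae_lt_top (hm k) (hne k))), ← lintegral_indicator hA.1]
      congr 1
      refine lintegral_congr fun x => ?_
      by_cases hx : x ∈ A <;> simp [hx]
    rw [hset, hset, lintegral_mul_truncSum_top_succ η θ ω n hω (measurable_one.indicator hA.1)]
    intro x u c hu
    by_cases hx : x ∈ A
    · rw [Set.indicator_of_mem hx, Set.indicator_of_mem ((hA.2 x u c hu).2 hx)]; rfl
    · rw [Set.indicator_of_notMem hx,
        Set.indicator_of_notMem fun h => hx ((hA.2 x u c hu).1 h)]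

theorem ae_quenched_tendsto_truncSum {ω : ℕ → Θ}
    (hω : ∀ k, laplaceMean η (ω k) θ ≠ 0 ∧ laplaceMean η (ω k) θ ≠ ∞) :
    ∀ᵐ x ∂(quenchedMeasure η ω), ∃ l : ℝ≥0∞, l < ∞ ∧
      Tendsto (fun n => truncSum η θ ⊤ ω x n) atTop (𝓝 l) := by
  have hm := measurable_truncSum_right η θ ⊤ ω
  have hint := lintegral_truncSum_top η θ ω
  have hbdd : ∀ n, eLpNorm (fun x => (truncSum η θ ⊤ ω x n).toReal) 1 (quenchedMeasure η ω)
      ≤ (1 : NNReal) := by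
    intro n
    rw [eLpNorm_one_eq_lintegral_enorm, ENNReal.coe_one, ← hint n hω]
    refine lintegral_mono fun x => ?_
    rw [Real.enorm_of_nonneg ENNReal.toReal_nonneg]
    exact ENNReal.ofReal_toReal_le
  have hfin : ∀ᵐ x ∂(quenchedMeasure η ω), ∀ n, truncSum η θ ⊤ ω x n < ∞ :=
    ae_all_iff.2 fun n => ae_lt_top (hm n) (by rw [hint n hω]; exact ENNReal.one_ne_top)
  filter_upwards [(martingale_truncSum hω).submartingale.exists_ae_tendsto_of_bdd hbdd, hfin]
    with x ⟨l, hx⟩ hx'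
  refine ⟨_, ENNReal.ofReal_lt_top, ((ENNReal.continuous_ofReal.tendsto _).comp hx).congr ?_⟩
  intro n
  exact ENNReal.ofReal_toReal (hx' n).ne

theorem ae_annealed_of_ae_env {p : Θ → Prop} (hp : ∀ᵐ e ∂ν, p e) :
    ∀ᵐ q ∂(annealedLaw ν η), ∀ k, p (q.1 k) := by
  obtain ⟨A, hA, hAm, hAp⟩ := hp.exists_measurable_mem
  have h1 : ∀ᵐ ω ∂(envLaw ν), ∀ k, ω k ∈ A := ae_forall_coord ν hA
  have hm : MeasurableSet {ω : ℕ → Θ | ∀ k, ω k ∈ A} := by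
    rw [Set.ofPred_forall]
    exact MeasurableSet.iInter fun k => measurable_pi_apply k hAm
  filter_upwards [Measure.ae_compProd_of_ae_fst (quenchedLaw η) hm h1] with q hq k
  exact hAp _ (hq k)

theorem measurable_limsup_truncSum : Measurable fun p : (ℕ → Θ) × Family =>
    limsup (fun n => truncSum η θ ⊤ p.1 p.2 n) atTop :=
  Measurable.limsup fun n => measurable_truncSum η θ ⊤ n

theorem ae_tendsto_truncSum (hm : ∀ᵐ e ∂ν, laplaceMean η e θ ≠ 0 ∧ laplaceMean η e θ ≠ ∞) :
    ∀ᵐ p ∂(annealedLaw ν η), limsup (fun n => truncSum η θ ⊤ p.1 p.2 n) atTop < ∞ ∧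
      Tendsto (fun n => truncSum η θ ⊤ p.1 p.2 n) atTop
        (𝓝 (limsup (fun n => truncSum η θ ⊤ p.1 p.2 n) atTop)) := by
  have hmeas : MeasurableSet {p : (ℕ → Θ) × Family |
      limsup (fun n => truncSum η θ ⊤ p.1 p.2 n) atTop < ∞ ∧
        liminf (fun n => truncSum η θ ⊤ p.1 p.2 n) atTop
          = limsup (fun n => truncSum η θ ⊤ p.1 p.2 n) atTop} :=
    (measurableSet_lt measurable_limsup_truncSum measurable_const).inter
      (measurableSet_eq_fun (Measurable.liminf fun n => measurable_truncSum η θ ⊤ n)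
        measurable_limsup_truncSum)
  have h : ∀ᵐ p ∂(annealedLaw ν η), limsup (fun n => truncSum η θ ⊤ p.1 p.2 n) atTop < ∞ ∧
      liminf (fun n => truncSum η θ ⊤ p.1 p.2 n) atTop
        = limsup (fun n => truncSum η θ ⊤ p.1 p.2 n) atTop := by
    refine Measure.ae_compProd_of_ae_ae hmeas ?_
    filter_upwards [ae_forall_coord ν hm] with ω hω
    have := ae_quenched_tendsto_truncSum hω
    filter_upwards [this] with x ⟨l, hl, hlim⟩
    rw [hlim.limsup_eq, hlim.liminf_eq]
    exact ⟨hl, rfl⟩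
  filter_upwards [h] with p hp
  exact ⟨hp.1, tendsto_of_liminf_eq_limsup hp.2 rfl⟩

theorem lintegral_annealed_truncSum_top
    (hm : ∀ᵐ e ∂ν, laplaceMean η e θ ≠ 0 ∧ laplaceMean η e θ ≠ ∞) (n : ℕ) :
    ∫⁻ p, truncSum η θ ⊤ p.1 p.2 n ∂(annealedLaw ν η) = 1 := by
  rw [lintegral_annealedLaw ν η (measurable_truncSum η θ ⊤ n)]
  rw [lintegral_congr_ae (g := fun _ => 1), lintegral_const, measure_univ, mul_one]
  have : ∀ᵐ ω ∂(envLaw ν), ∀ k, _ := ae_forall_coord ν hm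
  filter_upwards [this] with ω hω
  exact lintegral_truncSum_top η θ ω n hω

theorem lintegral_limsup_truncSum_le_one
    (hm : ∀ᵐ e ∂ν, laplaceMean η e θ ≠ 0 ∧ laplaceMean η e θ ≠ ∞) :
    ∫⁻ p, limsup (fun n => truncSum η θ ⊤ p.1 p.2 n) atTop ∂(annealedLaw ν η) ≤ 1 := by
  calc ∫⁻ p, limsup (fun n => truncSum η θ ⊤ p.1 p.2 n) atTop ∂(annealedLaw ν η)
      = ∫⁻ p, liminf (fun n => truncSum η θ ⊤ p.1 p.2 n) atTop ∂(annealedLaw ν η) := by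
        refine lintegral_congr_ae ?_
        filter_upwards [ae_tendsto_truncSum hm] with p hp
        exact hp.2.liminf_eq.symm
    _ ≤ liminf (fun n => ∫⁻ p, truncSum η θ ⊤ p.1 p.2 n ∂(annealedLaw ν η)) atTop :=
        lintegral_liminf_le fun n => measurable_truncSum η θ ⊤ n
    _ = 1 := by simp [lintegral_annealed_truncSum_top hm]

/-! ### The dichotomy for the limit -/

/-- Fatou's lemma in the other direction, for sequences bounded below by a sequence that is
bounded in mean square. -/
theorem le_lintegral_of_sq_bounded {Ω : Type*} [MeasurableSpace Ω] {μ : Measure Ω}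
    [IsProbabilityMeasure μ] {g w : ℕ → Ω → ℝ≥0∞} {l : Ω → ℝ≥0∞}
    (hg : ∀ n, Measurable (g n)) (hw : ∀ n, Measurable (w n))
    (hgw : ∀ n x, g n x ≤ w n x) (hlim : ∀ᵐ x ∂μ, Tendsto (fun n => w n x) atTop (𝓝 (l x)))
    {p B : ℝ≥0∞} (hp : ∀ n, p ≤ ∫⁻ x, g n x ∂μ) (hB : B ≠ ∞)
    (hgB : ∀ n, ∫⁻ x, g n x ^ 2 ∂μ ≤ B) :
    p ≤ ∫⁻ x, l x ∂μ := by
  have hK : ∀ K : ℕ, 0 < K → p ≤ ∫⁻ x, l x ∂μ + B / K := by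
    intro K hK0
    have hK0' : (K : ℝ≥0∞) ≠ 0 := by exact_mod_cast hK0.ne'
    -- the mass of `g` lost by cutting at `K` is at most its second moment over `K`
    have hpt : ∀ a : ℝ≥0∞, a ≤ min a K + a ^ 2 / K := by
      intro a
      rcases le_total a K with h | h
      · rw [min_eq_left h]; exact le_self_add
      · refine le_trans ?_ le_add_self
        calc a = a * K / K := (ENNReal.mul_div_cancel_right hK0' (ENNReal.natCast_ne_top K)).symm
          _ ≤ a ^ 2 / K := by rw [sq]; gcongr
    have h1 : ∀ n, p ≤ ∫⁻ x, min (w n x) K ∂μ + B / K := by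
      intro n
      calc p ≤ ∫⁻ x, g n x ∂μ := hp n
        _ ≤ ∫⁻ x, (min (w n x) K + g n x ^ 2 / K) ∂μ :=
            lintegral_mono fun x => (hpt _).trans (by gcongr; exact hgw n x)
        _ = ∫⁻ x, min (w n x) K ∂μ + (∫⁻ x, g n x ^ 2 ∂μ) / K := by
            rw [lintegral_add_left ((hw n).min measurable_const)]
            simp_rw [div_eq_mul_inv]
            rw [lintegral_mul_const _ ((hg n).pow_const 2)]
        _ ≤ _ := by gcongr; exact hgB n
    have h2 : Tendsto (fun n => ∫⁻ x, min (w n x) K ∂μ) atTop (𝓝 (∫⁻ x, min (l x) K ∂μ)) := by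
      refine tendsto_lintegral_of_dominated_convergence (fun _ => (K : ℝ≥0∞))
        (fun n => (hw n).min measurable_const) (fun n => ae_of_all _ fun x => min_le_right _ _)
        ?_ ?_
      · rw [lintegral_const, measure_univ, mul_one]; exact ENNReal.natCast_ne_top K
      · filter_upwards [hlim] with x hx
        exact hx.min tendsto_const_nhds
    refine (ge_of_tendsto' (h2.add_const (B / K)) h1).trans ?_
    gcongr
    exact min_le_left _ _
  have h3 : Tendsto (fun K : ℕ => ∫⁻ x, l x ∂μ + B / K) atTop (𝓝 (∫⁻ x, l x ∂μ + 0)) :=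
    tendsto_const_nhds.add (ENNReal.Tendsto.const_div ENNReal.tendsto_nat_nhds_top (Or.inr hB)
      |>.trans (by simp))
  rw [add_zero] at h3
  refine ge_of_tendsto h3 ?_
  filter_upwards [eventually_gt_atTop 0] with K hK0 using hK K hK0

/-- Almost surely, the barrier condition for the tilted walk is a condition on the logarithms. -/
theorem ae_mem_belowBarrier_iff [IsProbabilityMeasure (tiltLaw ν η θ)]
    (hm : ∀ᵐ e ∂ν, laplaceMean η e θ ≠ 0 ∧ laplaceMean η e θ ≠ ∞) :
    ∀ᵐ y ∂(Measure.infinitePi fun _ : ℕ => tiltLaw ν η θ), ∀ (β : ℕ → ℝ) (n : ℕ),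
      y ∈ belowBarrier η θ (fun k => ENNReal.ofReal (Real.exp (β k))) n ↔
        ∀ k < n, Real.log (familyMass η θ (y k).1 (y k).2.1).toReal
          - ∑ i ∈ Finset.range k, tiltStep η θ (y i) ≤ β k := by
  filter_upwards [ae_forall_coord _ (ae_neg_tiltStep_le hm),
    ae_forall_coord _ (ae_tiltLaw_of_ae (η := η) (θ := θ) hm)] with y h1 h2 β n
  refine forall₂_congr fun k _ => ?_
  have hX : familyMass η θ (y k).1 (y k).2.1 = ENNReal.ofReal
      (Real.exp (Real.log (familyMass η θ (y k).1 (y k).2.1).toReal)) := by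
    rw [Real.exp_log (ENNReal.toReal_pos (h1 k).2.1 (h1 k).1), ENNReal.ofReal_toReal (h1 k).1]
  have hP : ∏ j ∈ Finset.range k, tiltDensity η θ (y j)
      = ENNReal.ofReal (Real.exp (-∑ i ∈ Finset.range k, tiltStep η θ (y i))) := by
    rw [Finset.prod_congr rfl fun j _ => tiltDensity_eq_exp (h2 j).1 (h2 j).2,
      ← ENNReal.ofReal_prod_of_nonneg fun _ _ => (Real.exp_pos _).le, ← Real.exp_sum,
      Finset.sum_neg_distrib]
  rw [hP]
  conv_lhs => rw [hX]
  rw [← ENNReal.ofReal_mul (Real.exp_pos _).le, ← Real.exp_add,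
    ENNReal.ofReal_le_ofReal_iff (Real.exp_pos _).le, Real.exp_le_exp, neg_add_eq_sub]

/-- If the tilted walk dominates a linear function and the masses of the families, the limit of
the martingale has mean one: with the barrier `exp (a - c k)` almost all the mass is kept as
`a → ∞`, and the truncated sums are bounded in mean square. -/
theorem one_le_lintegral_limsup_truncSum [IsProbabilityMeasure (tiltLaw ν η θ)]
    (hm : ∀ᵐ e ∂ν, laplaceMean η e θ ≠ 0 ∧ laplaceMean η e θ ≠ ∞) {c : ℝ} (hc : 0 < c)
    (hwalk : ∀ᵐ y ∂(Measure.infinitePi fun _ : ℕ => tiltLaw ν η θ),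
      BddAbove (Set.range fun k : ℕ => Real.log (familyMass η θ (y k).1 (y k).2.1).toReal
        - ∑ i ∈ Finset.range k, tiltStep η θ (y i) + c * k)) :
    1 ≤ ∫⁻ p, limsup (fun n => truncSum η θ ⊤ p.1 p.2 n) atTop ∂(annealedLaw ν η) := by
  set μ := Measure.infinitePi fun _ : ℕ => tiltLaw ν η θ
  set A : ℕ → Set (ℕ → Θ × PointConfig × ℕ) := fun a => {y | ∀ k : ℕ,
    Real.log (familyMass η θ (y k).1 (y k).2.1).toReal
      - ∑ i ∈ Finset.range k, tiltStep η θ (y i) ≤ a - c * k} with hA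
  have hmono : Monotone A := by
    intro a a' haa' y hy k
    have : (a : ℝ) ≤ a' := by exact_mod_cast haa'
    exact (hy k).trans (by linarith)
  have hfull : μ (⋃ a, A a) = 1 := by
    rw [← measure_univ (μ := μ)]
    refine measure_congr (eventuallyEq_univ.2 ?_)
    filter_upwards [hwalk] with y ⟨M, hM⟩
    obtain ⟨a, ha⟩ := exists_nat_ge M
    refine Set.mem_iUnion.2 ⟨a, fun k => ?_⟩
    have := hM ⟨k, rfl⟩
    simp only at this
    linarith
  rw [← hfull, hmono.measure_iUnion]
  refine iSup_le fun a => ?_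
  set b : ℕ → ℝ≥0∞ := fun k => ENNReal.ofReal (Real.exp (a - c * k)) with hb
  have hbsum : ∑' k, b k ≠ ∞ := by
    have hs : Summable fun k : ℕ => Real.exp (a - c * k) := by
      have : (fun k : ℕ => Real.exp (a - c * k))
          = fun k : ℕ => Real.exp a * Real.exp (-c) ^ k := by
        funext k
        rw [← Real.exp_nat_mul, ← Real.exp_add]
        congr 1; ring
      rw [this]
      exact (summable_geometric_of_lt_one (Real.exp_pos _).le
        (Real.exp_lt_one_iff.2 (by linarith))).mul_left _
    rw [hb, ← ENNReal.ofReal_tsum_of_nonneg (fun k => (Real.exp_pos _).le) hs]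
    exact ENNReal.ofReal_ne_top
  refine le_lintegral_of_sq_bounded (g := fun n p => truncSum η θ b p.1 p.2 n)
    (w := fun n p => truncSum η θ ⊤ p.1 p.2 n) (B := 1 + ∑' k, b k)
    (measurable_truncSum η θ b) (measurable_truncSum η θ ⊤)
    (fun n p => truncSum_le_top η θ b p.1 p.2 n)
    ((ae_tendsto_truncSum hm).mono fun p hp => hp.2) (fun n => ?_)
    (ENNReal.add_ne_top.2 ⟨ENNReal.one_ne_top, hbsum⟩) fun n => ?_
  · rw [lintegral_truncSum]
    refine measure_mono_ae ?_
    filter_upwards [ae_mem_belowBarrier_iff hm] with y hy hyA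
    exact (hy (fun k => a - c * k) n).2 fun k _ => hyA k
  · rw [lintegral_annealedLaw ν η ((measurable_truncSum η θ b n).pow_const 2)]
    calc ∫⁻ ω, ∫⁻ x, truncSum η θ b ω x n ^ 2 ∂(quenchedMeasure η ω) ∂(envLaw ν)
        ≤ ∫⁻ _, (1 + ∑' k, b k) ∂(envLaw ν) := by
          refine lintegral_mono_ae ?_
          have : ∀ᵐ ω ∂(envLaw ν), ∀ k, _ := ae_forall_coord ν hm
          filter_upwards [this] with ω hω
          refine (lintegral_truncSum_sq_le η θ b ω n hω).trans ?_
          gcongr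
          exact ENNReal.sum_le_tsum _
      _ = 1 + ∑' k, b k := by simp

/-- If the perturbed tilted walk crosses every level, the limit of the martingale vanishes: on the
event that the martingale never exceeds a level, nothing is truncated by a constant barrier,
while the mass below that barrier is lost. -/
theorem lintegral_limsup_truncSum_eq_zero [IsProbabilityMeasure (tiltLaw ν η θ)]
    (hm : ∀ᵐ e ∂ν, laplaceMean η e θ ≠ 0 ∧ laplaceMean η e θ ≠ ∞)
    (hwalk : ∀ᵐ y ∂(Measure.infinitePi fun _ : ℕ => tiltLaw ν η θ), ∀ a : ℝ, ∃ k : ℕ,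
      a < Real.log (familyMass η θ (y k).1 (y k).2.1).toReal
        - ∑ i ∈ Finset.range k, tiltStep η θ (y i)) :
    ∫⁻ p, limsup (fun n => truncSum η θ ⊤ p.1 p.2 n) atTop ∂(annealedLaw ν η) = 0 := by
  classical
  set μ := Measure.infinitePi fun _ : ℕ => tiltLaw ν η θ
  set b : ℕ → ℕ → ℝ≥0∞ := fun a _ => ENNReal.ofReal (Real.exp a) with hb
  have hlim0 : ∀ a, Tendsto (fun n => μ (belowBarrier η θ (b a) n)) atTop (𝓝 0) := by
    intro a
    have hanti : Antitone (belowBarrier η θ (b a)) := fun n n' hnn' y hy k hk =>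
      hy k (hk.trans_le hnn')
    have h1 := tendsto_measure_iInter_atTop (μ := μ)
      (fun n => (measurableSet_belowBarrier η θ (b a) n).nullMeasurableSet) hanti
      ⟨0, measure_ne_top _ _⟩
    have h0 : μ (⋂ n, belowBarrier η θ (b a) n) = 0 := by
      refine measure_eq_zero_iff_ae_notMem.2 ?_
      filter_upwards [hwalk, ae_mem_belowBarrier_iff hm] with y hy1 hy2 hmem
      obtain ⟨k, hk⟩ := hy1 a
      have := (hy2 (fun _ => (a : ℝ)) (k + 1)).1 (Set.mem_iInter.1 hmem (k + 1)) k k.lt_succ_self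
      exact absurd hk (not_lt.2 this)
    rwa [h0] at h1
  set Z : ℕ → (ℕ → Θ) × Family → ℝ≥0∞ := fun n p => truncSum η θ ⊤ p.1 p.2 n with hZ
  have hZm : ∀ n, Measurable (Z n) := measurable_truncSum η θ ⊤
  set E : ℕ → ℕ → Set ((ℕ → Θ) × Family) := fun a n =>
    {p | ∀ k < n, Z (k + 1) p ≤ ENNReal.ofReal (Real.exp a)} with hE
  have hEm : ∀ a n, MeasurableSet (E a n) := by
    intro a n
    simp only [hE, Set.ofPred_forall]
    exact MeasurableSet.iInter fun k => MeasurableSet.iInter fun _ =>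
      measurableSet_le (hZm _) measurable_const
  have hEle : ∀ a n p, (E a n).indicator (Z n) p ≤ truncSum η θ (b a) p.1 p.2 n := by
    intro a n p
    by_cases hp : p ∈ E a n
    · rw [Set.indicator_of_mem hp]
      exact (truncSum_eq_top hp).ge
    · rw [Set.indicator_of_notMem hp]; exact zero_le
  have hae : ∀ a, ∀ᵐ p ∂(annealedLaw ν η),
      liminf (fun n => (E a n).indicator (Z n) p) atTop = 0 := by
    intro a
    have hmeas : ∀ n, Measurable ((E a n).indicator (Z n)) := fun n =>
      (hZm n).indicator (hEm a n)
    refine (lintegral_eq_zero_iff (Measurable.liminf hmeas)).1 (le_antisymm ?_ zero_le)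
    refine (lintegral_liminf_le hmeas).trans ?_
    have : Tendsto (fun n => ∫⁻ p, (E a n).indicator (Z n) p ∂(annealedLaw ν η)) atTop (𝓝 0) := by
      refine tendsto_of_tendsto_of_tendsto_of_le_of_le tendsto_const_nhds (hlim0 a)
        (fun n => zero_le) fun n => ?_
      refine (lintegral_mono (hEle a n)).trans (le_of_eq ?_)
      exact lintegral_truncSum ν η θ (b a) n
    exact this.liminf_eq.le
  have hfin : ∀ᵐ p ∂(annealedLaw ν η), ∀ n, Z n p < ∞ :=
    ae_all_iff.2 fun n => ae_lt_top (hZm n) (by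
      rw [hZ, lintegral_annealed_truncSum_top hm n]; exact ENNReal.one_ne_top)
  rw [← lintegral_zero (μ := annealedLaw ν η)]
  refine lintegral_congr_ae ?_
  filter_upwards [ae_all_iff.2 hae, hfin, ae_tendsto_truncSum hm] with p h1 h2 h3
  -- a convergent sequence of finite numbers with a finite limit is bounded
  have hbdd : ∃ a : ℕ, ∀ k, Z k p ≤ ENNReal.ofReal (Real.exp a) := by
    have hr : Tendsto (fun n => (Z n p).toReal) atTop _ :=
      (ENNReal.tendsto_toReal h3.1.ne).comp h3.2
    obtain ⟨M, hM⟩ := hr.bddAbove_range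
    obtain ⟨a, ha⟩ := exists_nat_ge M
    refine ⟨a, fun k => ?_⟩
    rw [ENNReal.le_ofReal_iff_toReal_le (h2 k).ne (Real.exp_pos _).le]
    have h4 : (Z k p).toReal ≤ M := hM ⟨k, rfl⟩
    linarith [Real.add_one_le_exp (a : ℝ)]
  obtain ⟨a, ha⟩ := hbdd
  have h4 : (fun n => (E a n).indicator (Z n) p) = fun n => Z n p := by
    funext n
    exact Set.indicator_of_mem (show p ∈ E a n from fun k _ => ha _) _
  have h5 := h1 a
  rw [h4] at h5
  rw [← h5]
  exact h3.2.liminf_eq.symm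

end Convergence

/-! ### The law of the first generation -/

section Conclusion

variable {Θ : Type*} [MeasurableSpace Θ] {ν : Measure Θ} [IsProbabilityMeasure ν]
  {η : Kernel Θ PointConfig} [IsMarkovKernel η] {θ : ℝ}

theorem ae_W_eq_truncSum (hm : ∀ᵐ e ∂ν, laplaceMean η e θ ≠ 0 ∧ laplaceMean η e θ ≠ ∞) :
    ∀ᵐ p ∂(annealedLaw ν η), ∀ n, W η θ n p = truncSum η θ ⊤ p.1 p.2 n := by
  filter_upwards [ae_annealed_of_ae_env hm] with p hp n
  exact W_eq_truncSum η θ n hp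

theorem lintegral_W_one_eq (hm : ∀ᵐ e ∂ν, laplaceMean η e θ ≠ 0 ∧ laplaceMean η e θ ≠ ∞)
    {F : ℝ≥0∞ → ℝ≥0∞} (hF : Measurable F) :
    ∫⁻ p, F (W η θ 1 p) ∂(annealedLaw ν η)
      = ∫⁻ e, ∫⁻ c, F (familyMass η θ e c) ∂(η e) ∂ν := by
  have h1 : ∀ᵐ p ∂(annealedLaw ν η), F (W η θ 1 p) = F (familyMass η θ (p.1 0) (p.2 [])) := by
    filter_upwards [ae_W_eq_truncSum hm] with p hp
    rw [hp 1, truncSum_top_succ,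
      tsum_level_zero fun u => truncWeight η θ ⊤ p.1 p.2 u * familyMass η θ (p.1 0) (p.2 u)]
    simp [truncWeight]
  have hroot : Measurable fun p : (ℕ → Θ) × Family => (p.1 0, p.2 []) :=
    ((measurable_pi_apply 0).comp measurable_fst).prodMk
      ((measurable_pi_apply []).comp measurable_snd)
  have hmeas : Measurable fun p : (ℕ → Θ) × Family => F (familyMass η θ (p.1 0) (p.2 [])) :=
    hF.comp ((measurable_familyMass η θ).comp hroot)
  rw [lintegral_congr_ae h1, lintegral_annealedLaw ν η hmeas]
  have h2 : ∀ ω : ℕ → Θ, ∫⁻ x, F (familyMass η θ (ω 0) (x [])) ∂(quenchedMeasure η ω)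
      = ∫⁻ c, F (familyMass η θ (ω 0) c) ∂(η (ω 0)) := fun ω =>
    (measurePreserving_eval_infinitePi (fun u : List ℕ => η (ω u.length)) []).lintegral_comp
      (hF.comp (measurable_familyMass_right η θ (ω 0)))
  simp_rw [h2]
  exact (measurePreserving_eval_infinitePi (fun _ : ℕ => ν) 0).lintegral_comp
    (f := fun e => ∫⁻ c, F (familyMass η θ e c) ∂(η e))
    (Measurable.lintegral_kernel_prod_right (κ := η) (f := fun e c => F (familyMass η θ e c))
      (hF.comp (measurable_familyMass η θ)))

end Conclusion

end BRWRE

theorem theorem4 {Θ : Type*} [MeasurableSpace Θ]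
    (ν : Measure Θ) [IsProbabilityMeasure ν]
    (η : Kernel Θ BRWRE.PointConfig) [IsMarkovKernel η]
    (hfin : ∀ᵐ e ∂ν, ∀ᵐ c ∂(η e), c.1 < ⊤)
    (hpos : BRWRE.PosMeanLogOffspring ν η)
    (θ : ℝ) (hθ : θ ∈ interior (BRWRE.finiteDomain ν η))
    (δ : ℝ≥0∞) (hδ : 0 < δ) (hell : ∀ᵐ e ∂ν, δ < BRWRE.laplaceMean η e θ) :
    -- the quantity `κ` is well defined
    (∀ᵐ e ∂ν, DifferentiableAt ℝ (fun t => (BRWRE.laplaceMean η e t).toReal) θ) ∧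
    Integrable (BRWRE.kappaIntegrand η θ) ν ∧
    -- the martingale converges almost surely to a finite limit
    (∀ᵐ p ∂(BRWRE.annealedLaw ν η), BRWRE.Wlim η θ p < ∞ ∧
      Tendsto (fun n => BRWRE.W η θ n p) atTop (𝓝 (BRWRE.Wlim η θ p))) ∧
    -- the limit has mean one if and only if both conditions hold
    (∫⁻ p, BRWRE.Wlim η θ p ∂(BRWRE.annealedLaw ν η) = 1 ↔
      (∫⁻ p, ENNReal.ofReal ((BRWRE.W η θ 1 p).toReal * |Real.log (BRWRE.W η θ 1 p).toReal|)
          ∂(BRWRE.annealedLaw ν η) < ∞ ∧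
        0 < ∫ e, BRWRE.kappaIntegrand η θ e ∂ν)) ∧
    -- and it has mean zero if one of them fails
    (¬ (∫⁻ p, ENNReal.ofReal ((BRWRE.W η θ 1 p).toReal * |Real.log (BRWRE.W η θ 1 p).toReal|)
          ∂(BRWRE.annealedLaw ν η) < ∞ ∧
        0 < ∫ e, BRWRE.kappaIntegrand η θ e ∂ν) →
      ∫⁻ p, BRWRE.Wlim η θ p ∂(BRWRE.annealedLaw ν η) = 0) := by
  have hm := BRWRE.ae_laplaceMean_ne hθ hell
  have : IsProbabilityMeasure (BRWRE.tiltLaw ν η θ) := BRWRE.isProbabilityMeasure_tiltLaw hm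
  obtain ⟨hκint, hκ⟩ := BRWRE.integrable_kappaIntegrand_and_integral_eq hθ hδ hell
  have hW := BRWRE.ae_W_eq_truncSum hm
  have hWlim : ∀ᵐ p ∂(BRWRE.annealedLaw ν η), BRWRE.Wlim η θ p
      = limsup (fun n => BRWRE.truncSum η θ ⊤ p.1 p.2 n) atTop := by
    filter_upwards [hW] with p hp
    simp only [BRWRE.Wlim, hp]
  have hstep := BRWRE.measurable_tiltStep η θ
  have hmass := (BRWRE.measurable_familyMass_coord η θ).ennreal_toReal.log
  have hL2 := BRWRE.memLp_tiltStep hθ hδ hell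
  have hL1 := hL2.integrable one_le_two
  have hle := (BRWRE.ae_neg_tiltStep_le hm).mono fun s hs => hs.2.2
  have hXlogX : ∫⁻ p, ENNReal.ofReal ((BRWRE.W η θ 1 p).toReal
        * |Real.log (BRWRE.W η θ 1 p).toReal|) ∂(BRWRE.annealedLaw ν η) < ∞ ↔
      ∫⁻ s, ENNReal.ofReal (Real.log (BRWRE.familyMass η θ s.1 s.2.1).toReal)
        ∂(BRWRE.tiltLaw ν η θ) < ∞ := by
    rw [BRWRE.lintegral_log_familyMass_lt_top_iff, BRWRE.lintegral_W_one_eq hm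
      (F := fun a => ENNReal.ofReal (a.toReal * |Real.log a.toReal|)) (by fun_prop)]
  rw [lintegral_congr_ae hWlim, hXlogX, hκ]
  have hone : (∫⁻ s, ENNReal.ofReal (Real.log (BRWRE.familyMass η θ s.1 s.2.1).toReal)
        ∂(BRWRE.tiltLaw ν η θ) < ∞ ∧ 0 < ∫ s, BRWRE.tiltStep η θ s ∂(BRWRE.tiltLaw ν η θ)) →
      ∫⁻ p, limsup (fun n => BRWRE.truncSum η θ ⊤ p.1 p.2 n) atTop
        ∂(BRWRE.annealedLaw ν η) = 1 := by
    rintro ⟨hlog, hdrift⟩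
    refine le_antisymm (BRWRE.lintegral_limsup_truncSum_le_one hm) ?_
    set κ := ∫ s, BRWRE.tiltStep η θ s ∂(BRWRE.tiltLaw ν η θ)
    have hc : 0 < κ / 3 := by positivity
    refine BRWRE.one_le_lintegral_limsup_truncSum hm hc
      (BRWRE.ae_bddAbove_perturbed_walk _ hstep hmass hL1 ?_ hc ?_)
    · refine ⟨(hmass.max measurable_const).aestronglyMeasurable, ?_⟩
      rw [hasFiniteIntegral_iff_ofReal (ae_of_all _ fun s => by simp)]
      simpa [ENNReal.ofReal_max] using hlog
    · change 2 * (κ / 3) < κ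
      linarith
  have hzero : ¬ (∫⁻ s, ENNReal.ofReal (Real.log (BRWRE.familyMass η θ s.1 s.2.1).toReal)
        ∂(BRWRE.tiltLaw ν η θ) < ∞ ∧ 0 < ∫ s, BRWRE.tiltStep η θ s ∂(BRWRE.tiltLaw ν η θ)) →
      ∫⁻ p, limsup (fun n => BRWRE.truncSum η θ ⊤ p.1 p.2 n) atTop
        ∂(BRWRE.annealedLaw ν η) = 0 := by
    intro h
    refine BRWRE.lintegral_limsup_truncSum_eq_zero hm ?_
    by_cases hlog : ∫⁻ s, ENNReal.ofReal (Real.log (BRWRE.familyMass η θ s.1 s.2.1).toReal)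
        ∂(BRWRE.tiltLaw ν η θ) < ∞
    · refine BRWRE.ae_unbounded_of_walk_unbounded _ hle ?_
      rcases (not_lt.1 fun hd => h ⟨hlog, hd⟩).lt_or_eq with hneg | hcent
      · exact BRWRE.ae_walk_unbounded_of_neg _ hstep hL1 hneg
      · exact BRWRE.ae_walk_unbounded_of_centered _ hstep hL2 hcent
          (BRWRE.not_ae_tiltStep_eq_zero hpos hm)
    · exact BRWRE.ae_unbounded_of_not_integrable _ hstep hmass hL1 (not_lt_top_iff.1 hlog)
  refine ⟨(BRWRE.ae_hasDerivAt_laplaceMean hθ).mono fun e he => he.differentiableAt, hκint, ?_,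
    ⟨fun h1 => ?_, hone⟩, hzero⟩
  · filter_upwards [hW, hWlim, BRWRE.ae_tendsto_truncSum hm] with p h1 h2 h3
    simp only [h1, h2]
    exact h3
  · by_contra hnot
    rw [hzero hnot] at h1
    exact zero_ne_one h1
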